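/- Let $K=\mathbb{Q}(\sqrt5)$ with algebraic conjugation ${}'$ ($\sqrt5\mapsto-\sqrt5$), let $\tau=(1+\sqrt5)/2$ and $\mathfrak{o}=\mathbb{Z}[\tau]$. In the quaternion algebra $\mathbb{H}(K)\subset\mathbb{H}(\mathbb{R})=\mathbb{R}^4$ write $q=(a,b,c,d)=a+\mathbf{i}b+\mathbf{j}c+\mathbf{k}d$, let $|q|$ be the Euclidean length, so that $|q|^2=q\bar q\in K$, and let $\widetilde q=(a',b',d',c')$ be the twist of $q$. Let $\mathbb{I}$ be the icosian ring, i.e. the set of all $\mathfrak{o}$-linear combinations of $(1,0,0,0)$, $(0,1,0,0)$, $\tfrac12(1,1,1,1)$, $\tfrac12(1-\tau,\tau,0,1)$, and let $$L=\bigl\langle(1,0,0,0),\ \tfrac12(-1,1,1,1),\ (0,-1,0,0),\ \tfrac12(0,1,\tau-1,-\tau)\bigr\rangle_{\mathbb{Z}},$$ a copy of the root lattice $A_4$ rescaled by $1/\sqrt2$. An icosian $p\in\mathbb{I}$ is called primitive if $\alpha p\in\mathbb{I}$ with $\alpha\in K$ implies $\alpha\in\mathfrak{o}$, and admissible if $|p\widetilde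 p|\in\mathbb{N}$. For $a,b\in\mathbb{I}$, $\operatorname{glcd}(a,b)$ denotes a greatest left common divisor of $a$ and $b$ in $\mathbb{I}$, which is determined up to right multiplication by a unit of $\mathbb{I}$. Let $p_1,p_2\in\mathbb{I}$ be primitive and admissible. Then $$L\cap\tfrac{1}{|p_1\widetilde p_1|}\,p_1L\widetilde p_1 \;=\; L\cap\tfrac{1}{|p_2\widetilde p_2|}\,p_2L\widetilde p_2$$ if and only if both of the following conditions hold: 1. $|p_1|^2=|p_2|^2$ up to a unit of $\mathfrak{o}$, i.e. $|p_1|^2=\varepsilon\,|p_2|^2$ for some $\varepsilon\in\mathfrak{o}^\times$; 2. $\operatorname{glcd}\bigl(p_1,|p_1\widetilde p_1|/c\bigr)=\operatorname{glcd}\bigl(p_2,|p_2\widetilde p_2|/c\bigr)$ up to right multiplication by a unit of $\mathbb{I}$, where $c=\sqrt5$ if $|p_1|^2$ (equivalently, by the first condition, $|p_2|^2$) is divisible by $5$ in $\mathfrak{o}$, and $c=1$ otherwise. -/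

import Mathlib

open scoped Quaternion

/-- The quadratic field `K = ℚ(√5)`, presented as `ℚ[ω]` with `ω ^ 2 = 5`; `star` is the
algebraic conjugation `√5 ↦ -√5`. -/
abbrev GoldenField : Type := QuadraticAlgebra ℚ 5 0

instance instFactGoldenField : Fact (∀ r : ℚ, r ^ 2 ≠ 5 + 0 * r) := ⟨by
  intro r hr
  have h5 : Irrational (Real.sqrt 5) := by
    simpa using (by norm_num : Nat.Prime 5).irrational_sqrt
  have hr' : (r : ℝ) ^ 2 = 5 := by
    have : r ^ 2 = 5 := by linarith
    exact_mod_cast this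
  apply h5
  refine ⟨|r|, ?_⟩
  rw [← hr', Real.sqrt_sq_eq_abs]
  push_cast
  rfl⟩

namespace GoldenField

/-- `√5` as an element of `K`. -/
def sqrtFive : GoldenField := ⟨0, 1⟩

/-- The golden ratio `τ = (1 + √5) / 2` as an element of `K`. -/
def tau : GoldenField := ⟨1 / 2, 1 / 2⟩

theorem tau_mul_tau : tau * tau = tau + 1 := by
  refine QuadraticAlgebra.ext ?_ ?_
  · change (1 / 2 * (1 / 2) + 5 * (1 / 2) * (1 / 2) : ℚ) = 1 / 2 + 1
    norm_num
  · change (1 / 2 * (1 / 2) + 1 / 2 * (1 / 2) + 0 * (1 / 2) * (1 / 2) : ℚ) = 1 / 2 + 0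
    norm_num

/-- The real embedding of `K` with `√5 ↦ √5 > 0`. -/
noncomputable def toReal : GoldenField →ₐ[ℚ] ℝ :=
  QuadraticAlgebra.lift ⟨Real.sqrt 5, by
    rw [Real.mul_self_sqrt (by norm_num), zero_smul, add_zero, Rat.smul_def]
    norm_num⟩

/-- The ring `𝔬 = ℤ[τ] = {m + n τ | m, n ∈ ℤ}`. -/
def integers : Subring GoldenField where
  carrier := {x | ∃ m n : ℤ, x = m + n * tau}
  mul_mem' := by
    rintro _ _ ⟨a, b, rfl⟩ ⟨c, d, rfl⟩
    refine ⟨a * c + b * d, a * d + b * c + b * d, ?_⟩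
    push_cast
    linear_combination (b * d : GoldenField) * tau_mul_tau
  one_mem' := ⟨1, 0, by simp⟩
  add_mem' := by
    rintro _ _ ⟨a, b, rfl⟩ ⟨c, d, rfl⟩
    exact ⟨a + c, b + d, by push_cast; ring⟩
  zero_mem' := ⟨0, 0, by simp⟩
  neg_mem' := by
    rintro _ ⟨a, b, rfl⟩
    exact ⟨-a, -b, by push_cast; ring⟩

end GoldenField

open GoldenField

/-- The icosian ring `𝕀`: the `𝔬`-linear combinations of `(1,0,0,0)`, `(0,1,0,0)`,
`(1,1,1,1)/2` and `(1-τ,τ,0,1)/2` in `ℍ(K)`. -/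
def icosians : Submodule integers ℍ[GoldenField] :=
  Submodule.span integers
    {⟨1, 0, 0, 0⟩, ⟨0, 1, 0, 0⟩, ⟨1 / 2, 1 / 2, 1 / 2, 1 / 2⟩,
      ⟨(1 - tau) / 2, tau / 2, 0, 1 / 2⟩}

/-- The twist map `(a,b,c,d) ↦ (a',b',d',c')`, with `'` the algebraic conjugation of `K`. -/
def twist (q : ℍ[GoldenField]) : ℍ[GoldenField] :=
  ⟨star q.re, star q.imI, star q.imK, star q.imJ⟩

/-- The inclusion of `ℍ(K)` into `ℍ(ℝ) = ℝ⁴`. -/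
noncomputable def quatToReal (q : ℍ[GoldenField]) : ℍ[ℝ] :=
  ⟨toReal q.re, toReal q.imI, toReal q.imJ, toReal q.imK⟩

/-- The Euclidean length `|q q̃|`. -/
noncomputable def twistLength (q : ℍ[GoldenField]) : ℝ :=
  ‖quatToReal (q * twist q)‖

/-- `q` is an icosian, and `α q` with `α ∈ K` is an icosian only for `α ∈ 𝔬`. -/
def IsPrimitiveIcosian (q : ℍ[GoldenField]) : Prop :=
  q ∈ icosians ∧ ∀ α : GoldenField, α • q ∈ icosians → α ∈ integers

/-- The realisation `L` in `ℝ⁴ = ℍ(ℝ)` of the root lattice `A₄` (rescaled by `1/√2`). -/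
noncomputable def latticeL : Submodule ℤ ℍ[ℝ] :=
  Submodule.span ℤ
    {⟨1, 0, 0, 0⟩, ⟨-1 / 2, 1 / 2, 1 / 2, 1 / 2⟩, ⟨0, -1, 0, 0⟩,
      ⟨0, 1 / 2, (Real.goldenRatio - 1) / 2, -Real.goldenRatio / 2⟩}

/-- The rotation `R(q) : x ↦ q x q̃ / |q q̃|` of `ℝ⁴ = ℍ(ℝ)`. -/
noncomputable def icosianRotation (q : ℍ[GoldenField]) : ℍ[ℝ] →ₗ[ℝ] ℍ[ℝ] :=
  (1 / twistLength q) •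
    (LinearMap.mulLeft ℝ (quatToReal q) ∘ₗ LinearMap.mulRight ℝ (quatToReal (twist q)))

/-- The lattice `L ∩ R(q) L`. -/
noncomputable def icosianCSL (q : ℍ[GoldenField]) : Submodule ℤ ℍ[ℝ] :=
  latticeL ⊓ latticeL.map ((icosianRotation q).restrictScalars ℤ)

/-- `d` is a left divisor of `a` in `𝕀`. -/
def IcosianLeftDvd (d a : ℍ[GoldenField]) : Prop :=
  ∃ x ∈ icosians, a = d * x

/-- `g` is a greatest left common divisor of `a` and `b` in `𝕀`. -/
def IsIcosianGLCD (g a b : ℍ[GoldenField]) : Prop :=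
  g ∈ icosians ∧ IcosianLeftDvd g a ∧ IcosianLeftDvd g b ∧
    ∀ d ∈ icosians, IcosianLeftDvd d a → IcosianLeftDvd d b → IcosianLeftDvd d g

open Classical in
/-- `c = √5` if `5` divides `|q|²` in `𝔬`, and `c = 1` otherwise. -/
noncomputable def fiveCorrection (q : ℍ[GoldenField]) : GoldenField :=
  if ∃ x ∈ integers, Quaternion.normSq q = 5 * x then sqrtFive else 1

/-! Write N for the reduced norm, R(p) for the rotation and n = |p p̃|, so that N(p) N(p)' = n². The
lattice L consists of the icosians fixed by the twist. For the form 2 Re(x ȳ) its dual is L* = {(z -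
z̃)/√5 : z ∈ 𝕀}, because 𝕀 is unimodular over 𝔬 and the trace dual of 𝔬 is 𝔬/√5. Hence L ∩ R(p)L has
dual D(p) = L* + R(p)L*, and D(p) is governed by the right module M(p) = p𝕀 + (n/√5)𝕀: n D(p) lies
in M(p) (`exists_mul_dual_mul_twist`), while any right 𝕀-module containing D(p) contains p/n,
because p̃ is primitive (`IsPrimitiveIcosian.smul_mem_of_dualLattice_le`).

Necessity: equal intersections have equal duals, so (n₂/n₁)p₁ ∈ M(p₂) and conversely. Primitivity
forces n₁ = n₂ = n, and if 5 ∤ n the denominator √5 can be removed. Thus p₁𝕀 + (n/c)𝕀 = p₂𝕀 +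
(n/c)𝕀. As 𝕀 is norm-Euclidean, such an ideal is generated by a glcd, so the glcds agree. Taking
norms and using N(pᵢ) N(pᵢ)' = n² shows that N(p₁) and N(p₂) are associates
(`exists_unit_of_mem_rightSpan`).

Sufficiency: the norm condition gives n₁ = n₂, the glcd condition gives p₂ = p₁s + (n/c)t, and this
is substituted into x ↦ p̄₂ x conj(p̃₂). Only the mixed terms for 5 ∣ n are not visibly divisible by
n: a factor √5 is missing from an element of the form z - z̃. Modulo √5 such elements form a line
spanned by an icosian of norm 3, so one whose norm is divisible by √5 is itself divisible by √5
(`exists_sub_twist_eq_sqrtFive_smul`). -/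

namespace GoldenField

/-! ### Arithmetic of `𝔬` and its conjugation -/

theorem star_tau : star tau = 1 - tau := by
  refine QuadraticAlgebra.ext ?_ ?_ <;> norm_num [tau, QuadraticAlgebra.re_one,
    QuadraticAlgebra.im_one]

theorem sqrtFive_eq : sqrtFive = 2 * tau - 1 := by
  rw [two_mul]
  refine QuadraticAlgebra.ext ?_ ?_ <;> simp [tau, sqrtFive, QuadraticAlgebra.re_one,
    QuadraticAlgebra.im_one] <;> norm_num

theorem star_sqrtFive : star sqrtFive = -sqrtFive := by
  refine QuadraticAlgebra.ext ?_ ?_ <;> simp [sqrtFive]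

theorem sqrtFive_mul_sqrtFive : sqrtFive * sqrtFive = 5 := by
  rw [sqrtFive_eq]
  linear_combination 4 * tau_mul_tau

theorem sqrtFive_ne_zero : sqrtFive ≠ 0 := by
  intro h
  have := sqrtFive_mul_sqrtFive
  rw [h] at this
  norm_num at this

theorem star_natCast' (n : ℕ) : star (n : GoldenField) = n := by simp

theorem star_intCast' (n : ℤ) : star (n : GoldenField) = n := by simp

theorem intCast_mem_integers (n : ℤ) : (n : GoldenField) ∈ integers := intCast_mem _ n

theorem tau_mem_integers : tau ∈ integers := ⟨0, 1, by simp⟩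

theorem sqrtFive_mem_integers : sqrtFive ∈ integers :=
  ⟨-1, 2, by rw [sqrtFive_eq]; push_cast; ring⟩

theorem star_mem_integers {x : GoldenField} (hx : x ∈ integers) : star x ∈ integers := by
  obtain ⟨m, n, rfl⟩ := hx
  refine ⟨m + n, -n, ?_⟩
  rw [star_add, star_mul', star_tau, star_intCast', star_intCast']
  push_cast
  ring

/-- `τ` as an element of `𝔬`. -/
def tauInt : integers := ⟨tau, tau_mem_integers⟩

theorem coe_two : ((2 : integers) : GoldenField) = 2 := rfl

theorem coe_tauInt : (tauInt : GoldenField) = tau := rfl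

theorem add_star_eq (x : GoldenField) : x + star x = ((2 * x.re : ℚ) : GoldenField) := by
  refine QuadraticAlgebra.ext ?_ ?_ <;> simp [two_mul]

theorem mul_star_eq_intCast {x : GoldenField} (hx : x ∈ integers) :
    ∃ k : ℤ, x * star x = k := by
  obtain ⟨m, n, rfl⟩ := hx
  refine ⟨m ^ 2 + m * n - n ^ 2, ?_⟩
  rw [star_add, star_mul', star_tau, star_intCast', star_intCast']
  push_cast
  linear_combination (-n ^ 2 : GoldenField) * tau_mul_tau

/-- The prime 5 ramifies, so conjugation is trivial modulo `√5`. The congruences modulo `√5` below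
rest on this. -/
theorem sub_star_eq {x : GoldenField} (hx : x ∈ integers) :
    ∃ k : ℤ, x - star x = sqrtFive * k := by
  obtain ⟨m, n, rfl⟩ := hx
  refine ⟨n, ?_⟩
  rw [star_add, star_mul', star_tau, star_intCast', star_intCast', sqrtFive_eq]
  ring

/-- A rational number in `𝔬` is an integer. -/
theorem exists_int_of_ratCast_mem {r : ℚ} (h : (r : GoldenField) ∈ integers) :
    ∃ k : ℤ, r = k := by
  obtain ⟨m, n, h⟩ := h
  have him := congrArg QuadraticAlgebra.im h
  have hre := congrArg QuadraticAlgebra.re h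
  simp [tau] at him hre
  subst him
  exact ⟨m, by simpa using hre⟩

/-- The trace dual of `𝔬` is `𝔬 / √5`. -/
theorem mem_integers_of_trace {x : GoldenField}
    (h1 : ∃ k : ℤ, x / sqrtFive + star (x / sqrtFive) = k)
    (h2 : ∃ k : ℤ, tau * x / sqrtFive + star (tau * x / sqrtFive) = k) : x ∈ integers := by
  obtain ⟨k, hk⟩ := h1
  obtain ⟨l, hl⟩ := h2
  rw [star_div₀, star_sqrtFive] at hk hl
  rw [star_mul', star_tau] at hl
  have h0 := sqrtFive_ne_zero
  have hk' : x - star x = sqrtFive * k := by rw [← hk]; field_simp; ring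
  have hl' : tau * x - (1 - tau) * star x = sqrtFive * l := by rw [← hl]; field_simp; ring
  -- For x = m + kτ the first trace is k, and τx = k + (m + k)τ makes the second one l = m + k.
  refine ⟨l - k, k, ?_⟩
  rw [← mul_right_inj' h0]
  push_cast
  have := sqrtFive_eq
  linear_combination hl' + (tau - 1) * hk' + x * this

end GoldenField

/-- The quaternion with the given coordinates in the `𝔬`-basis of the icosian ring. -/
def icosianOf (a b c d : GoldenField) : ℍ[GoldenField] :=
  ⟨a + c / 2 + d * (1 - tau) / 2, b + c / 2 + d * tau / 2, c / 2, c / 2 + d / 2⟩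

/-! ### Coordinates on the icosians and closure under product, conjugation and twist -/

@[simp] theorem re_icosianOf (a b c d : GoldenField) :
    (icosianOf a b c d).re = a + c / 2 + d * (1 - tau) / 2 := rfl

@[simp] theorem imI_icosianOf (a b c d : GoldenField) :
    (icosianOf a b c d).imI = b + c / 2 + d * tau / 2 := rfl

@[simp] theorem imJ_icosianOf (a b c d : GoldenField) : (icosianOf a b c d).imJ = c / 2 := rfl

@[simp] theorem imK_icosianOf (a b c d : GoldenField) :
    (icosianOf a b c d).imK = c / 2 + d / 2 := rfl

@[simp] theorem re_twist (q : ℍ[GoldenField]) : (twist q).re = star q.re := rfl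

@[simp] theorem imI_twist (q : ℍ[GoldenField]) : (twist q).imI = star q.imI := rfl

@[simp] theorem imJ_twist (q : ℍ[GoldenField]) : (twist q).imJ = star q.imK := rfl

@[simp] theorem imK_twist (q : ℍ[GoldenField]) : (twist q).imK = star q.imJ := rfl

theorem smul_quaternion_eq (a : integers) (q : ℍ[GoldenField]) :
    a • q = (a : GoldenField) • q := rfl

theorem mem_span_four {R M : Type*} [Ring R] [AddCommGroup M] [Module R M] {x y z w q : M} :
    q ∈ Submodule.span R {x, y, z, w} ↔
      ∃ a b c d : R, q = a • x + b • y + c • z + d • w := by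
  simp only [Submodule.mem_span_insert, Submodule.mem_span_singleton]
  constructor
  · rintro ⟨a, _, ⟨b, _, ⟨c, _, ⟨d, rfl⟩, rfl⟩, rfl⟩, rfl⟩
    exact ⟨a, b, c, d, by abel⟩
  · rintro ⟨a, b, c, d, rfl⟩
    exact ⟨a, _, ⟨b, _, ⟨c, _, ⟨d, rfl⟩, rfl⟩, rfl⟩, by abel⟩

theorem mem_icosians_iff {q : ℍ[GoldenField]} :
    q ∈ icosians ↔ ∃ a b c d : integers, q = icosianOf a b c d := by
  refine mem_span_four.trans (exists_congr fun a => exists_congr fun b => exists_congr fun c =>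
    exists_congr fun d => ?_)
  rw [show (⟨1, 0, 0, 0⟩ : ℍ[GoldenField]) = icosianOf 1 0 0 0 by
      apply Quaternion.ext <;> simp,
    show (⟨0, 1, 0, 0⟩ : ℍ[GoldenField]) = icosianOf 0 1 0 0 by
      apply Quaternion.ext <;> simp,
    show (⟨1 / 2, 1 / 2, 1 / 2, 1 / 2⟩ : ℍ[GoldenField]) = icosianOf 0 0 1 0 by
      apply Quaternion.ext <;> simp,
    show (⟨(1 - tau) / 2, tau / 2, 0, 1 / 2⟩ : ℍ[GoldenField]) = icosianOf 0 0 0 1 by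
      apply Quaternion.ext <;> simp]
  rw [show icosianOf a b c d = a • icosianOf 1 0 0 0 + b • icosianOf 0 1 0 0 +
    c • icosianOf 0 0 1 0 + d • icosianOf 0 0 0 1 by
      apply Quaternion.ext <;> simp [smul_quaternion_eq] <;> ring]

theorem icosianOf_mem (a b c d : integers) : icosianOf a b c d ∈ icosians :=
  mem_icosians_iff.2 ⟨a, b, c, d, rfl⟩

theorem icosianOf_coords (q : ℍ[GoldenField]) :
    q = icosianOf (q.re - q.imJ - (q.imK - q.imJ) * (1 - tau))
      (q.imI - q.imJ - (q.imK - q.imJ) * tau) (2 * q.imJ) (2 * (q.imK - q.imJ)) := by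
  apply Quaternion.ext <;> simp <;> ring

theorem icosianOf_mem_of_mem {a b c d : GoldenField} (ha : a ∈ integers) (hb : b ∈ integers)
    (hc : c ∈ integers) (hd : d ∈ integers) : icosianOf a b c d ∈ icosians :=
  icosianOf_mem ⟨a, ha⟩ ⟨b, hb⟩ ⟨c, hc⟩ ⟨d, hd⟩

theorem mul_mem_icosians {p q : ℍ[GoldenField]} (hp : p ∈ icosians) (hq : q ∈ icosians) :
    p * q ∈ icosians := by
  obtain ⟨a₁, b₁, c₁, d₁, rfl⟩ := mem_icosians_iff.1 hp
  obtain ⟨a₂, b₂, c₂, d₂, rfl⟩ := mem_icosians_iff.1 hq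
  have h := tau_mul_tau
  refine mem_icosians_iff.2 ⟨
    (a₁ * a₂ - b₁ * b₂ + (-1 + tauInt) * b₁ * c₂ - tauInt * c₁ * b₂ - c₁ * c₂ - c₁ * d₂ -
        tauInt * d₁ * b₂ - d₁ * d₂),
    (a₁ * b₂ + b₁ * a₂ + (1 - tauInt) * b₁ * c₂ + (1 - tauInt) * b₁ * d₂ + tauInt * c₁ * b₂ +
        c₁ * d₂ - d₁ * c₂),
    (a₁ * c₂ - b₁ * c₂ - b₁ * d₂ + c₁ * a₂ + c₁ * b₂ + c₁ * c₂ + d₁ * b₂ + (1 - tauInt) * d₁ * c₂),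
    (a₁ * d₂ + 2 * b₁ * c₂ + b₁ * d₂ - 2 * c₁ * b₂ + (1 - tauInt) * c₁ * d₂ + d₁ * a₂ - d₁ * b₂ +
        tauInt * d₁ * c₂ + (1 - tauInt) * d₁ * d₂), ?_⟩
  apply Quaternion.ext <;> simp [coe_tauInt, coe_two] <;> grind

theorem star_mem_icosians {q : ℍ[GoldenField]} (hq : q ∈ icosians) : star q ∈ icosians := by
  obtain ⟨a, b, c, d, rfl⟩ := mem_icosians_iff.1 hq
  refine mem_icosians_iff.2 ⟨a + c + (1 - tauInt) * d, -b, -c, -d, ?_⟩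
  apply Quaternion.ext <;> simp [coe_tauInt] <;> ring

theorem twist_icosianOf (a b c d : GoldenField) :
    twist (icosianOf a b c d) = icosianOf (star a) (star b) (star c + star d) (-star d) := by
  apply Quaternion.ext <;> simp [star_tau, star_div₀] <;> ring

theorem twist_mem_icosians {q : ℍ[GoldenField]} (hq : q ∈ icosians) : twist q ∈ icosians := by
  obtain ⟨a, b, c, d, rfl⟩ := mem_icosians_iff.1 hq
  rw [twist_icosianOf]
  exact icosianOf_mem_of_mem (star_mem_integers a.2) (star_mem_integers b.2)
    (add_mem (star_mem_integers c.2) (star_mem_integers d.2)) (neg_mem (star_mem_integers d.2))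

theorem coe_mem_icosians_iff {a : GoldenField} :
    (a : ℍ[GoldenField]) ∈ icosians ↔ a ∈ integers := by
  constructor
  · intro h
    obtain ⟨x, b, c, d, h⟩ := mem_icosians_iff.1 h
    have hJ := congrArg QuaternionAlgebra.imJ h
    have hK := congrArg QuaternionAlgebra.imK h
    have hR := congrArg QuaternionAlgebra.re h
    rw [Quaternion.imJ_coe, imJ_icosianOf] at hJ
    rw [Quaternion.imK_coe, imK_icosianOf] at hK
    rw [Quaternion.re_coe, re_icosianOf] at hR
    have : a = x := by linear_combination hR - hJ - (1 - tau) * (hK - hJ)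
    rw [this]
    exact x.2
  · intro h
    refine mem_icosians_iff.2 ⟨⟨a, h⟩, 0, 0, 0, ?_⟩
    apply Quaternion.ext <;> simp

theorem one_mem_icosians : (1 : ℍ[GoldenField]) ∈ icosians := by
  rw [← Quaternion.coe_one]
  exact coe_mem_icosians_iff.2 (one_mem _)

theorem smul_mem_icosians {a : GoldenField} {q : ℍ[GoldenField]} (ha : a ∈ integers)
    (hq : q ∈ icosians) : a • q ∈ icosians :=
  icosians.smul_mem ⟨a, ha⟩ hq

/-! ### Properties of the twist -/

theorem twist_add (p q : ℍ[GoldenField]) : twist (p + q) = twist p + twist q := by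
  apply Quaternion.ext <;> simp

theorem twist_sub (p q : ℍ[GoldenField]) : twist (p - q) = twist p - twist q := by
  apply Quaternion.ext <;> simp

theorem twist_mul (p q : ℍ[GoldenField]) : twist (p * q) = twist q * twist p := by
  apply Quaternion.ext <;> simp only [re_twist, imI_twist, imJ_twist, imK_twist, Quaternion.re_mul,
      Quaternion.imI_mul, Quaternion.imJ_mul,
    Quaternion.imK_mul, star_add, star_sub, star_mul'] <;> ring

theorem twist_smul (a : GoldenField) (q : ℍ[GoldenField]) : twist (a • q) = star a • twist q := by
  apply Quaternion.ext <;> simp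

theorem twist_twist (q : ℍ[GoldenField]) : twist (twist q) = q := by
  apply Quaternion.ext <;> simp

theorem twist_star (q : ℍ[GoldenField]) : twist (star q) = star (twist q) := by
  apply Quaternion.ext <;> simp

theorem normSq_twist (q : ℍ[GoldenField]) :
    Quaternion.normSq (twist q) = star (Quaternion.normSq q) := by
  simp only [Quaternion.normSq_def', re_twist, imI_twist, imJ_twist, imK_twist, star_add, star_pow]
  ring

/-! ### Reduced trace and norm on the icosians -/

theorem two_mul_re_mem {q : ℍ[GoldenField]} (hq : q ∈ icosians) : 2 * q.re ∈ integers := by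
  obtain ⟨a, b, c, d, rfl⟩ := mem_icosians_iff.1 hq
  have : 2 * (icosianOf (a : GoldenField) b c d).re =
      ((2 * a + c + d * (1 - tauInt) : integers) : GoldenField) := by
    simp [coe_tauInt, coe_two]
    ring
  rw [this]
  exact Subtype.prop _

theorem normSq_mem {q : ℍ[GoldenField]} (hq : q ∈ icosians) :
    Quaternion.normSq q ∈ integers := by
  rw [← coe_mem_icosians_iff, ← Quaternion.self_mul_star]
  exact mul_mem_icosians hq (star_mem_icosians hq)

theorem re_mul_comm (p q : ℍ[GoldenField]) : (p * q).re = (q * p).re := by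
  simp; ring

theorem normSq_add (p q : ℍ[GoldenField]) :
    Quaternion.normSq (p + q) =
      Quaternion.normSq p + 2 * (p * star q).re + Quaternion.normSq q := by
  simp [Quaternion.normSq_def']
  ring

theorem normSq_smul' (a : GoldenField) (q : ℍ[GoldenField]) :
    Quaternion.normSq (a • q) = a ^ 2 * Quaternion.normSq q := by
  simp [Quaternion.normSq_def']
  ring

theorem smul_mul_quaternion (a : GoldenField) (p q : ℍ[GoldenField]) :
    a • p * q = a • (p * q) := by
  apply Quaternion.ext <;> simp <;> ring

theorem mul_smul_quaternion (a : GoldenField) (p q : ℍ[GoldenField]) :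
    p * a • q = a • (p * q) := by
  apply Quaternion.ext <;> simp <;> ring

theorem two_mul_re_smul (a : GoldenField) (q : ℍ[GoldenField]) :
    2 * (a • q).re = a * (2 * q.re) := by
  rw [Quaternion.re_smul, smul_eq_mul]
  ring

theorem add_smul_quaternion (a b : GoldenField) (q : ℍ[GoldenField]) :
    (a + b) • q = a • q + b • q := by
  apply Quaternion.ext <;> simp <;> ring

theorem neg_smul_quaternion (a : GoldenField) (q : ℍ[GoldenField]) : -a • q = -(a • q) := by
  apply Quaternion.ext <;> simp

theorem smul_add_quaternion (a : GoldenField) (p q : ℍ[GoldenField]) :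
    a • (p + q) = a • p + a • q := by
  apply Quaternion.ext <;> simp

theorem smul_sub_quaternion (a : GoldenField) (p q : ℍ[GoldenField]) :
    a • (p - q) = a • p - a • q := by
  apply Quaternion.ext <;> simp <;> ring

theorem star_add_quaternion (p q : ℍ[GoldenField]) : star (p + q) = star p + star q := by
  apply Quaternion.ext <;> simp <;> ring

/-! ### Unimodularity of the trace form -/

/-- The coefficients of the four icosians are the rows of the inverse Gram matrix of the defining
basis. That matrix has entries in `𝔬`, which is unimodularity. -/
theorem icosianOf_trace (x : ℍ[GoldenField]) :
    x = icosianOf (2 * (x * star (icosianOf 2 (-1) (-tau) (2 * tau - 1))).re)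
      (2 * (x * star (icosianOf (-1) 2 (tau - 1) (1 - 2 * tau))).re)
      (2 * (x * star (icosianOf (-tau) (tau - 1) 2 (-2))).re)
      (2 * (x * star (icosianOf (2 * tau - 1) (1 - 2 * tau) (-2) 4)).re) := by
  have h := tau_mul_tau
  apply Quaternion.ext <;> simp <;> grind

/-- An `𝔬`-basis of the icosians dual to the defining one, for the trace form. -/
theorem dualBasis_mem :
    icosianOf 2 (-1) (-tau) (2 * tau - 1) ∈ icosians ∧
    icosianOf (-1) 2 (tau - 1) (1 - 2 * tau) ∈ icosians ∧
    icosianOf (-tau) (tau - 1) 2 (-2) ∈ icosians ∧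
    icosianOf (2 * tau - 1) (1 - 2 * tau) (-2) 4 ∈ icosians := by
  have ht := tau_mem_integers
  have h1 : (1 : GoldenField) ∈ integers := one_mem _
  have h2 : (2 : GoldenField) ∈ integers := ofNat_mem _ 2
  have h4 : (4 : GoldenField) ∈ integers := ofNat_mem _ 4
  have h5 : 2 * tau - 1 ∈ integers := sub_mem (mul_mem h2 ht) h1
  have h6 : 1 - 2 * tau ∈ integers := sub_mem h1 (mul_mem h2 ht)
  have h7 : tau - 1 ∈ integers := sub_mem ht h1
  exact ⟨icosianOf_mem_of_mem h2 (neg_mem h1) (neg_mem ht) h5,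
    icosianOf_mem_of_mem (neg_mem h1) h2 h7 h6,
    icosianOf_mem_of_mem (neg_mem ht) h7 h2 (neg_mem h2),
    icosianOf_mem_of_mem h5 h6 (neg_mem h2) h4⟩

theorem mem_icosians_of_trace {x : ℍ[GoldenField]}
    (h : ∀ y ∈ icosians, 2 * (x * y).re ∈ integers) : x ∈ icosians := by
  obtain ⟨h1, h2, h3, h4⟩ := dualBasis_mem
  rw [icosianOf_trace x]
  exact icosianOf_mem_of_mem (h _ (star_mem_icosians h1)) (h _ (star_mem_icosians h2))
    (h _ (star_mem_icosians h3)) (h _ (star_mem_icosians h4))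

/-- The quaternionic form of ∑ Eᵢⱼ x Eⱼᵢ = tr x, for a basis and its trace dual. It produces 1
inside a two-sided ideal that contains an element of trace 1. -/
theorem casimir (x : ℍ[GoldenField]) :
    icosianOf 1 0 0 0 * x * star (icosianOf 2 (-1) (-tau) (2 * tau - 1)) +
      icosianOf 0 1 0 0 * x * star (icosianOf (-1) 2 (tau - 1) (1 - 2 * tau)) +
      icosianOf 0 0 1 0 * x * star (icosianOf (-tau) (tau - 1) 2 (-2)) +
      icosianOf 0 0 0 1 * x * star (icosianOf (2 * tau - 1) (1 - 2 * tau) (-2) 4) =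
    ((2 * x.re : GoldenField) : ℍ[GoldenField]) := by
  have h := tau_mul_tau
  apply Quaternion.ext <;> simp <;> grind

/-! ### Positivity of the norm -/

theorem toReal_normSq (q : ℍ[GoldenField]) :
    toReal (Quaternion.normSq q) =
      toReal q.re ^ 2 + toReal q.imI ^ 2 + toReal q.imJ ^ 2 + toReal q.imK ^ 2 := by
  simp only [Quaternion.normSq_def', map_add, map_pow]

theorem toReal_injective : Function.Injective toReal := toReal.toRingHom.injective

theorem eq_zero_of_normSq_eq_zero {q : ℍ[GoldenField]} (h : Quaternion.normSq q = 0) : q = 0 := by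
  have h' := toReal_normSq q
  rw [h, map_zero] at h'
  have h0 : ∀ x : GoldenField, toReal x ^ 2 = 0 → x = 0 := fun x hx =>
    toReal_injective (by rw [map_zero]; exact pow_eq_zero_iff two_ne_zero |>.1 hx)
  have h1 := sq_nonneg (toReal q.re)
  have h2 := sq_nonneg (toReal q.imI)
  have h3 := sq_nonneg (toReal q.imJ)
  have h4 := sq_nonneg (toReal q.imK)
  apply Quaternion.ext
  · exact h0 _ (by linarith)
  · exact h0 _ (by linarith)
  · exact h0 _ (by linarith)
  · exact h0 _ (by linarith)

theorem ratCast_norm (x : GoldenField) :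
    ((QuadraticAlgebra.norm x : ℚ) : GoldenField) = x * star x :=
  QuadraticAlgebra.algebraMap_norm_eq_mul_star x

/-- The norm of `q` is totally positive: its conjugate is the norm of the twist, again a sum of four
squares. The field norm can thus serve as a Euclidean function. -/
theorem norm_normSq_nonneg (q : ℍ[GoldenField]) :
    0 ≤ QuadraticAlgebra.norm (Quaternion.normSq q) := by
  have h : ((QuadraticAlgebra.norm (Quaternion.normSq q) : ℚ) : ℝ) =
      toReal (Quaternion.normSq q) * toReal (Quaternion.normSq (twist q)) := by
    rw [normSq_twist, ← map_mul, ← ratCast_norm, map_ratCast]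
  have h2 : (0 : ℝ) ≤ (QuadraticAlgebra.norm (Quaternion.normSq q) : ℚ) := by
    rw [h, toReal_normSq, toReal_normSq]
    positivity
  exact_mod_cast h2

theorem norm_eq_intCast {x : GoldenField} (hx : x ∈ integers) :
    ∃ k : ℤ, QuadraticAlgebra.norm x = k := by
  obtain ⟨k, hk⟩ := mul_star_eq_intCast hx
  refine ⟨k, ?_⟩
  have : ((QuadraticAlgebra.norm x : ℚ) : GoldenField) = ((k : ℚ) : GoldenField) := by
    rw [ratCast_norm, hk, Rat.cast_intCast]
  exact_mod_cast this

/-! ### Division with remainder -/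

theorem exists_integers_norm_sub_lt (x : GoldenField) :
    ∃ y ∈ integers, |QuadraticAlgebra.norm (x - y)| < 1 := by
  obtain ⟨u, v⟩ := x
  obtain ⟨S, hS⟩ : ∃ S : ℤ, |u + v - S| ≤ 1 / 2 := ⟨_, abs_sub_round _⟩
  obtain ⟨T, hT⟩ : ∃ T : ℤ, |2 * v - T| ≤ 1 / 2 := ⟨_, abs_sub_round _⟩
  -- For y = m + nτ one has re + im = m + n and 2 im = n. In the errors s, t of these coordinates
  -- the norm is s² - st - t².
  refine ⟨((S - T : ℤ) : GoldenField) + (T : ℤ) * tau, ⟨_, _, rfl⟩, ?_⟩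
  have h : (⟨u, v⟩ : GoldenField) - (((S - T : ℤ) : GoldenField) + (T : ℤ) * tau) =
      ⟨(u + v - S) - (2 * v - T) / 2, (2 * v - T) / 2⟩ := by
    refine QuadraticAlgebra.ext ?_ ?_ <;> simp [tau] <;> ring
  rw [h, QuadraticAlgebra.norm_def]
  simp only
  generalize u + v - S = s at hS
  generalize 2 * v - T = t at hT
  rw [abs_le] at hS hT
  rw [abs_lt]
  constructor <;> nlinarith

/-- The parity relative to the nearest integer may be prescribed: keeping it costs error at most
1/2, changing it error at most 1. -/
theorem exists_round (f : ℚ) : ∃ z₀ : ℤ, ∀ δ : ℤ, δ = 0 ∨ δ = 1 →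
    ∃ z : ℤ, (z - z₀ - δ) % 2 = 0 ∧ (f - z) ^ 2 ≤ (1 + 3 * δ) / 4 := by
  have h := abs_sub_round f
  refine ⟨round f, ?_⟩
  rw [abs_le] at h
  rintro δ (rfl | rfl)
  · refine ⟨round f, by simp, ?_⟩
    push_cast
    nlinarith
  · rcases le_total (0 : ℚ) (f - round f) with h0 | h0
    · refine ⟨round f + 1, by simp, ?_⟩
      push_cast
      nlinarith
    · refine ⟨round f - 1, by ring_nf; rfl, ?_⟩
      push_cast
      nlinarith

/-- The `[8, 4]` Hamming code has covering radius at most `2`. -/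
theorem exists_parity_correction (w₁ w₂ w₃ w₄ : ℤ) : ∃ a b c d e f g h : ℤ,
    ((a = 0 ∨ a = 1) ∧ (b = 0 ∨ b = 1) ∧ (c = 0 ∨ c = 1) ∧ (d = 0 ∨ d = 1) ∧
      (e = 0 ∨ e = 1) ∧ (f = 0 ∨ f = 1) ∧ (g = 0 ∨ g = 1) ∧ (h = 0 ∨ h = 1)) ∧
    a + b + c + d + e + f + g + h ≤ 2 ∧
    (w₁ + (a - b - g + 2 * h - f)) % 2 = 0 ∧ (w₂ + (b + g - h - e)) % 2 = 0 ∧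
    (w₃ + (c - d - e + 2 * f - h)) % 2 = 0 ∧ (w₄ + (d - f - g + e)) % 2 = 0 := by
  rcases Int.emod_two_eq_zero_or_one w₁ with h₁ | h₁ <;>
  rcases Int.emod_two_eq_zero_or_one w₂ with h₂ | h₂ <;>
  rcases Int.emod_two_eq_zero_or_one w₃ with h₃ | h₃ <;>
  rcases Int.emod_two_eq_zero_or_one w₄ with h₄ | h₄
  · exact ⟨0, 0, 0, 0, 0, 0, 0, 0, by omega⟩
  · exact ⟨1, 0, 0, 0, 0, 1, 0, 0, by omega⟩
  · exact ⟨0, 0, 1, 0, 0, 0, 0, 0, by omega⟩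
  · exact ⟨0, 0, 0, 1, 0, 0, 0, 0, by omega⟩
  · exact ⟨1, 1, 0, 0, 0, 0, 0, 0, by omega⟩
  · exact ⟨1, 0, 0, 0, 0, 0, 1, 0, by omega⟩
  · exact ⟨0, 0, 0, 0, 0, 0, 0, 1, by omega⟩
  · exact ⟨0, 0, 0, 0, 1, 0, 0, 0, by omega⟩
  · exact ⟨1, 0, 0, 0, 0, 0, 0, 0, by omega⟩
  · exact ⟨0, 0, 0, 0, 0, 1, 0, 0, by omega⟩
  · exact ⟨1, 0, 1, 0, 0, 0, 0, 0, by omega⟩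
  · exact ⟨1, 0, 0, 1, 0, 0, 0, 0, by omega⟩
  · exact ⟨0, 1, 0, 0, 0, 0, 0, 0, by omega⟩
  · exact ⟨0, 0, 0, 0, 0, 0, 1, 0, by omega⟩
  · exact ⟨1, 0, 0, 0, 0, 0, 0, 1, by omega⟩
  · exact ⟨1, 0, 0, 0, 1, 0, 0, 0, by omega⟩

/-- The four congruences make the first two basis coordinates integral. The other two are 2 imJ and
2 (imK - imJ), which are integral anyway. -/
theorem mem_icosians_of_parity {a b c d e f g h : ℤ} {q : ℍ[GoldenField]}
    (h₁ : (a - b - g + 2 * h - f) % 2 = 0) (h₂ : (b + g - h - e) % 2 = 0)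
    (h₃ : (c - d - e + 2 * f - h) % 2 = 0) (h₄ : (d - f - g + e) % 2 = 0)
    (hR : 2 * q.re = (a - b : ℤ) + (b : ℤ) * tau) (hI : 2 * q.imI = (c - d : ℤ) + (d : ℤ) * tau)
    (hJ : 2 * q.imJ = (e - f : ℤ) + (f : ℤ) * tau) (hK : 2 * q.imK = (g - h : ℤ) + (h : ℤ) * tau) :
    q ∈ icosians := by
  obtain ⟨w₁, h₁⟩ := Int.dvd_of_emod_eq_zero h₁
  obtain ⟨w₂, h₂⟩ := Int.dvd_of_emod_eq_zero h₂
  obtain ⟨w₃, h₃⟩ := Int.dvd_of_emod_eq_zero h₃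
  obtain ⟨w₄, h₄⟩ := Int.dvd_of_emod_eq_zero h₄
  have k₁ := congrArg (Int.cast : ℤ → GoldenField) h₁
  have k₂ := congrArg (Int.cast : ℤ → GoldenField) h₂
  have k₃ := congrArg (Int.cast : ℤ → GoldenField) h₃
  have k₄ := congrArg (Int.cast : ℤ → GoldenField) h₄
  push_cast at k₁ k₂ k₃ k₄ hR hI hJ hK
  have ht := tau_mul_tau
  rw [icosianOf_coords q]
  refine icosianOf_mem_of_mem ⟨w₁, w₂, ?_⟩ ⟨w₃, w₄, ?_⟩ ⟨e - f, f, ?_⟩ ⟨g - h - (e - f), h - f, ?_⟩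
  · grind
  · grind
  · rw [hJ]; push_cast; ring
  · rw [mul_sub, hJ, hK]; push_cast; ring

/-- If N(q) = P + R√5, the bracket is the rational form P + R, for which the icosians are a copy of
the E₈ lattice; and 5/4 (P + R)² - (P² - 5R²) = (P + 5R)²/4. -/
theorem norm_normSq_le (q : ℍ[GoldenField]) :
    QuadraticAlgebra.norm (Quaternion.normSq q) ≤ 5 / 4 *
      ((q.re.re + q.re.im) ^ 2 + (2 * q.re.im) ^ 2 + ((q.imI.re + q.imI.im) ^ 2 +
          (2 * q.imI.im) ^ 2)
      + ((q.imJ.re + q.imJ.im) ^ 2 + (2 * q.imJ.im) ^ 2)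
      + ((q.imK.re + q.imK.im) ^ 2 + (2 * q.imK.im) ^ 2)) ^ 2 := by
  have h1 : ∀ x : GoldenField, (x ^ 2).re = x.re ^ 2 + 5 * x.im ^ 2 := by
    intro x; rw [pow_two]; simp; ring
  have h2 : ∀ x : GoldenField, (x ^ 2).im = 2 * x.re * x.im := by
    intro x; rw [pow_two]; simp; ring
  rw [QuadraticAlgebra.norm_def, Quaternion.normSq_def']
  simp only [QuadraticAlgebra.re_add, QuadraticAlgebra.im_add, h1, h2]
  generalize hP : q.re.re ^ 2 + 5 * q.re.im ^ 2 + (q.imI.re ^ 2 + 5 * q.imI.im ^ 2) +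
    (q.imJ.re ^ 2 + 5 * q.imJ.im ^ 2) + (q.imK.re ^ 2 + 5 * q.imK.im ^ 2) = P
  generalize hR : 2 * q.re.re * q.re.im + 2 * q.imI.re * q.imI.im + 2 * q.imJ.re * q.imJ.im +
    2 * q.imK.re * q.imK.im = R
  have : (q.re.re + q.re.im) ^ 2 + (2 * q.re.im) ^ 2 +
      ((q.imI.re + q.imI.im) ^ 2 + (2 * q.imI.im) ^ 2)
      + ((q.imJ.re + q.imJ.im) ^ 2 + (2 * q.imJ.im) ^ 2)
      + ((q.imK.re + q.imK.im) ^ 2 + (2 * q.imK.im) ^ 2) = P + R := by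
    rw [← hP, ← hR]; ring
  rw [this]
  nlinarith [sq_nonneg (P + 5 * R)]

/-- The icosian ring is norm-Euclidean. -/
theorem exists_icosian_norm_sub_lt (x : ℍ[GoldenField]) :
    ∃ y ∈ icosians, QuadraticAlgebra.norm (Quaternion.normSq (x - y)) < 1 := by
  -- At most two of the eight coordinates change parity, so Q ≤ (8 + 3 · 2)/16 = 7/8, and 5/4 ·
  -- 49/64 < 1.
  have bound : ∀ Q : ℚ, 0 ≤ Q → Q ≤ 7 / 8 → 5 / 4 * Q ^ 2 < 1 := by
    intro Q h₀ h₁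
    nlinarith
  obtain ⟨a₀, ha⟩ := exists_round (2 * (x.re.re + x.re.im))
  obtain ⟨b₀, hb⟩ := exists_round (4 * x.re.im)
  obtain ⟨c₀, hc⟩ := exists_round (2 * (x.imI.re + x.imI.im))
  obtain ⟨d₀, hd⟩ := exists_round (4 * x.imI.im)
  obtain ⟨e₀, he⟩ := exists_round (2 * (x.imJ.re + x.imJ.im))
  obtain ⟨f₀, hf⟩ := exists_round (4 * x.imJ.im)
  obtain ⟨g₀, hg⟩ := exists_round (2 * (x.imK.re + x.imK.im))
  obtain ⟨h₀, hh⟩ := exists_round (4 * x.imK.im)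
  obtain ⟨a₁, b₁, c₁, d₁, e₁, f₁, g₁, h₁, ⟨ha₁, hb₁, hc₁, hd₁, he₁, hf₁, hg₁, hh₁⟩, hs, p₁, p₂, p₃,
      p₄⟩ :=
    exists_parity_correction (a₀ - b₀ - g₀ + 2 * h₀ - f₀) (b₀ + g₀ - h₀ - e₀)
      (c₀ - d₀ - e₀ + 2 * f₀ - h₀) (d₀ - f₀ - g₀ + e₀)
  obtain ⟨a, pa, ha⟩ := ha _ ha₁
  obtain ⟨b, pb, hb⟩ := hb _ hb₁
  obtain ⟨c, pc, hc⟩ := hc _ hc₁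
  obtain ⟨d, pd, hd⟩ := hd _ hd₁
  obtain ⟨e, pe, he⟩ := he _ he₁
  obtain ⟨f, pf, hf⟩ := hf _ hf₁
  obtain ⟨g, pg, hg⟩ := hg _ hg₁
  obtain ⟨h, ph, hh⟩ := hh _ hh₁
  have half : ∀ s t : ℤ, 2 * (⟨(s : ℚ) / 2 - t / 4, t / 4⟩ : GoldenField) =
      (s - t : ℤ) + (t : ℤ) * tau := by
    intro s t
    rw [two_mul]
    refine QuadraticAlgebra.ext ?_ ?_ <;> simp [tau] <;> ring
  obtain ⟨y, yR, yI, yJ, yK⟩ : ∃ y : ℍ[GoldenField], y.re = ⟨(a : ℚ) / 2 - b / 4, b / 4⟩ ∧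
      y.imI = ⟨(c : ℚ) / 2 - d / 4, d / 4⟩ ∧ y.imJ = ⟨(e : ℚ) / 2 - f / 4, f / 4⟩ ∧
      y.imK = ⟨(g : ℚ) / 2 - h / 4, h / 4⟩ := ⟨⟨_, _, _, _⟩, rfl, rfl, rfl, rfl⟩
  refine ⟨y, ?_, ?_⟩
  · exact mem_icosians_of_parity (a := a) (b := b) (c := c) (d := d) (e := e) (f := f) (g := g)
      (h := h) (by omega) (by omega) (by omega) (by omega) (yR ▸ half _ _) (yI ▸ half _ _)
      (yJ ▸ half _ _) (yK ▸ half _ _)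
  · refine (norm_normSq_le _).trans_lt ?_
    simp only [Quaternion.re_sub, Quaternion.imI_sub, Quaternion.imJ_sub, Quaternion.imK_sub,
      QuadraticAlgebra.re_sub, QuadraticAlgebra.im_sub, yR, yI, yJ, yK]
    have hs' : (a₁ + b₁ + c₁ + d₁ + e₁ + f₁ + g₁ + h₁ : ℚ) ≤ 2 := by exact_mod_cast hs
    have key : ∀ (u v : ℚ) (s t : ℤ), (u - (s / 2 - t / 4) + (v - t / 4)) ^ 2 +
        (2 * (v - t / 4)) ^ 2
        = ((2 * (u + v) - s) ^ 2 + (4 * v - t) ^ 2) / 4 := by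
      intro u v s t; ring
    rw [key, key, key, key]
    set Q : ℚ := ((2 * (x.re.re + x.re.im) - a) ^ 2 + (4 * x.re.im - b) ^ 2) / 4 +
      ((2 * (x.imI.re + x.imI.im) - c) ^ 2 + (4 * x.imI.im - d) ^ 2) / 4 +
      ((2 * (x.imJ.re + x.imJ.im) - e) ^ 2 + (4 * x.imJ.im - f) ^ 2) / 4 +
      ((2 * (x.imK.re + x.imK.im) - g) ^ 2 + (4 * x.imK.im - h) ^ 2) / 4 with hQ
    have hQ0 : 0 ≤ Q := by positivity
    have hQ1 : Q ≤ 7 / 8 := by linarith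
    exact bound Q hQ0 hQ1

/-! ### Principal ideals -/

theorem norm_ne_zero {x : GoldenField} (hx : x ≠ 0) : QuadraticAlgebra.norm x ≠ 0 :=
  fun h => hx (QuadraticAlgebra.norm_eq_zero_iff_eq_zero.1 h)

/-- Every ideal of `𝔬` is principal. -/
theorem exists_generator (A : AddSubgroup GoldenField) (hA : ∀ x ∈ A, x ∈ integers)
    (hmul : ∀ x ∈ A, ∀ y ∈ integers, y * x ∈ A) :
    ∃ α ∈ A, ∀ x ∈ A, ∃ y ∈ integers, x = y * α := by
  by_cases h0 : ∃ x ∈ A, x ≠ 0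
  · have hex : ∃ k : ℕ, ∃ x ∈ A, x ≠ 0 ∧ |QuadraticAlgebra.norm x| = k := by
      obtain ⟨x, hx, hx0⟩ := h0
      obtain ⟨k, hk⟩ := norm_eq_intCast (hA x hx)
      exact ⟨k.natAbs, x, hx, hx0, by rw [hk, Nat.cast_natAbs]; simp⟩
    classical
    obtain ⟨α, hα, hα0, hk⟩ := Nat.find_spec hex
    refine ⟨α, hα, fun x hx => ?_⟩
    obtain ⟨y, hy, hlt⟩ := exists_integers_norm_sub_lt (x / α)
    refine ⟨y, hy, ?_⟩
    by_contra hne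
    have hr0 : x - y * α ≠ 0 := sub_ne_zero.2 hne
    have hr : x - y * α ∈ A := A.sub_mem hx (hmul _ hα _ hy)
    obtain ⟨l, hl⟩ := norm_eq_intCast (hA _ hr)
    have hle := Nat.find_min' hex (m := l.natAbs)
      ⟨_, hr, hr0, by rw [hl, Nat.cast_natAbs]; simp⟩
    have heq : x - y * α = (x / α - y) * α := by field_simp
    have h1 : |QuadraticAlgebra.norm (x - y * α)| < |QuadraticAlgebra.norm α| := by
      rw [heq, map_mul, abs_mul]
      exact mul_lt_of_lt_one_left (abs_pos.2 (norm_ne_zero hα0)) hlt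
    rw [hk, hl] at h1
    have h2 : ((l.natAbs : ℕ) : ℚ) < (Nat.find hex : ℕ) := by
      rw [Nat.cast_natAbs]; push_cast; exact h1
    exact absurd hle (not_le.2 (by exact_mod_cast h2))
  · push Not at h0
    exact ⟨0, A.zero_mem, fun x hx => ⟨0, zero_mem _, by rw [h0 x hx, zero_mul]⟩⟩

/-- Any two icosians generate a principal right ideal. -/
theorem exists_icosian_bezout {a b : ℍ[GoldenField]} (ha : a ∈ icosians) (hb : b ∈ icosians) :
    ∃ g ∈ icosians, IcosianLeftDvd g a ∧ IcosianLeftDvd g b ∧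
      ∃ x ∈ icosians, ∃ y ∈ icosians, g = a * x + b * y := by
  have hmem : ∀ x ∈ icosians, ∀ y ∈ icosians, a * x + b * y ∈ icosians := fun x hx y hy =>
    add_mem (mul_mem_icosians ha hx) (mul_mem_icosians hb hy)
  have hnorm : ∀ q ∈ icosians, ∃ k : ℕ, QuadraticAlgebra.norm (Quaternion.normSq q) = k := by
    intro q hq
    obtain ⟨k, hk⟩ := norm_eq_intCast (normSq_mem hq)
    have h0 := norm_normSq_nonneg q
    rw [hk] at h0
    lift k to ℕ using (by exact_mod_cast h0)
    exact ⟨k, by rw [hk]; rfl⟩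
  have h1 := one_mem_icosians
  have h0' := icosians.zero_mem
  by_cases hab : a = 0 ∧ b = 0
  · obtain ⟨rfl, rfl⟩ := hab
    exact ⟨0, h0', ⟨0, h0', by simp⟩, ⟨0, h0', by simp⟩, 0, h0', 0, h0', by simp⟩
  have hex : ∃ k : ℕ, ∃ x ∈ icosians, ∃ y ∈ icosians, a * x + b * y ≠ 0 ∧
      QuadraticAlgebra.norm (Quaternion.normSq (a * x + b * y)) = k := by
    by_cases ha0 : a = 0
    · obtain ⟨k, hk⟩ := hnorm b hb
      exact ⟨k, 0, h0', 1, h1, by simpa using fun h => hab ⟨ha0, h⟩, by simpa using hk⟩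
    · obtain ⟨k, hk⟩ := hnorm a ha
      exact ⟨k, 1, h1, 0, h0', by simpa using ha0, by simpa using hk⟩
  classical
  obtain ⟨x, hx, y, hy, hg0, hk⟩ := Nat.find_spec hex
  set g := a * x + b * y with hg
  have hgI : g ∈ icosians := hmem x hx y hy
  have hn0 : Quaternion.normSq g ≠ 0 := fun h => hg0 (eq_zero_of_normSq_eq_zero h)
  have key : ∀ u ∈ icosians, ∀ v ∈ icosians, IcosianLeftDvd g (a * u + b * v) := by
    intro u hu v hv
    obtain ⟨z, hz, hlt⟩ :=
      -- Left division by g, as g⁻¹ = N(g)⁻¹ ḡ. A nonzero remainder would contradict the minimality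
      -- of the norm of g.
      exists_icosian_norm_sub_lt ((Quaternion.normSq g)⁻¹ • (star g * (a * u + b * v)))
    refine ⟨z, hz, ?_⟩
    by_contra hne
    have hr : a * u + b * v - g * z = a * (u - x * z) + b * (v - y * z) := by
      rw [hg]; simp only [mul_sub, add_mul, mul_assoc]; abel
    have hux := sub_mem hu (mul_mem_icosians hx hz)
    have hvy := sub_mem hv (mul_mem_icosians hy hz)
    obtain ⟨l, hl⟩ := hnorm _ (hmem _ hux _ hvy)
    have hle := Nat.find_min' hex (m := l)
      ⟨_, hux, _, hvy, by rw [← hr]; exact sub_ne_zero.2 hne, hl⟩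
    have heq : a * u + b * v - g * z =
        g * ((Quaternion.normSq g)⁻¹ • (star g * (a * u + b * v)) - z) := by
      rw [mul_sub, mul_smul_quaternion, ← mul_assoc, Quaternion.self_mul_star,
          Quaternion.coe_mul_eq_smul,
        smul_smul, inv_mul_cancel₀ hn0, one_smul]
    have h1 : QuadraticAlgebra.norm (Quaternion.normSq (a * u + b * v - g * z)) <
        QuadraticAlgebra.norm (Quaternion.normSq g) := by
      rw [heq, map_mul, map_mul]
      exact mul_lt_of_lt_one_right
        (lt_of_le_of_ne (norm_normSq_nonneg g) (norm_ne_zero hn0).symm) hlt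
    rw [hr, hl, hk] at h1
    exact absurd hle (not_le.2 (by exact_mod_cast h1))
  refine ⟨g, hgI, ?_, ?_, x, hx, y, hy, rfl⟩
  · simpa using key 1 h1 0 h0'
  · simpa using key 0 h0' 1 h1

/-! ### Primitive icosians -/

/-- The traces of 𝕀q form an ideal (α). By unimodularity α⁻¹q is an icosian, so primitivity makes α
a unit. -/
theorem IsPrimitiveIcosian.exists_trace_eq_one {q : ℍ[GoldenField]} (hq : IsPrimitiveIcosian q) :
    ∃ y ∈ icosians, 2 * (y * q).re = 1 := by
  obtain ⟨hqI, hprim⟩ := hq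
  let A : AddSubgroup GoldenField :=
    { carrier := {t | ∃ y ∈ icosians, 2 * (y * q).re = t}
      zero_mem' := ⟨0, icosians.zero_mem, by simp⟩
      add_mem' := by
        rintro _ _ ⟨y, hy, rfl⟩ ⟨z, hz, rfl⟩
        exact ⟨y + z, add_mem hy hz, by rw [add_mul, Quaternion.re_add]; ring⟩
      neg_mem' := by
        rintro _ ⟨y, hy, rfl⟩
        exact ⟨-y, neg_mem hy, by simp; ring⟩ }
  obtain ⟨α, hα, hgen⟩ := exists_generator A
    (by rintro _ ⟨y, hy, rfl⟩; exact two_mul_re_mem (mul_mem_icosians hy hqI))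
    (by
      rintro _ ⟨y, hy, rfl⟩ z hz
      exact ⟨z • y, smul_mem_icosians hz hy, by
        rw [smul_mul_quaternion, two_mul_re_smul]⟩)
  have hα' : α⁻¹ ∈ integers := by
    refine hprim _ (mem_icosians_of_trace fun y hy => ?_)
    obtain ⟨z, hz, h⟩ := hgen _ ⟨y, hy, rfl⟩
    rw [smul_mul_quaternion, two_mul_re_smul, re_mul_comm, h]
    by_cases h0 : α = 0
    · rw [h0]; simp [zero_mem]
    · rw [mul_comm z, inv_mul_cancel_left₀ h0]
      exact hz
  have hα0 : α ≠ 0 := by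
    rintro rfl
    -- If α = 0, all traces vanish and every multiple of q is an icosian, so primitivity would put
    -- 1/2 in `𝔬`.
    have hz : ∀ a : GoldenField, a ∈ integers := by
      intro a
      refine hprim _ (mem_icosians_of_trace fun y hy => ?_)
      obtain ⟨z, hz, h⟩ := hgen _ ⟨y, hy, rfl⟩
      rw [smul_mul_quaternion, two_mul_re_smul, re_mul_comm, h]
      simp [zero_mem]
    obtain ⟨k, hk⟩ := exists_int_of_ratCast_mem (r := 1 / 2) (hz _)
    have : (1 : ℚ) = ((2 * k : ℤ) : ℚ) := by push_cast; linarith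
    have : (1 : ℤ) = 2 * k := by exact_mod_cast this
    omega
  obtain ⟨y, hy, h⟩ := hα
  exact ⟨α⁻¹ • y, smul_mem_icosians hα' hy, by
    rw [smul_mul_quaternion, two_mul_re_smul, h, inv_mul_cancel₀ hα0]⟩

theorem IsPrimitiveIcosian.isPrimitiveIcosian_twist {q : ℍ[GoldenField]}
    (hq : IsPrimitiveIcosian q) :
    IsPrimitiveIcosian (twist q) := by
  refine ⟨twist_mem_icosians hq.1, fun α h => ?_⟩
  have h' := twist_mem_icosians h
  rw [twist_smul, twist_twist] at h'
  simpa using star_mem_integers (hq.2 _ h')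

/-- A primitive icosian generates the unit two-sided ideal. -/
theorem IsPrimitiveIcosian.one_mem_of_mul_mem {q : ℍ[GoldenField]} (hq : IsPrimitiveIcosian q)
    (S : AddSubgroup ℍ[GoldenField]) (hS : ∀ x ∈ icosians, ∀ y ∈ icosians, x * q * y ∈ S) :
    (1 : ℍ[GoldenField]) ∈ S := by
  obtain ⟨y, hy, h⟩ := hq.exists_trace_eq_one
  have hc := casimir (y * q)
  rw [h, Quaternion.coe_one] at hc
  rw [← hc]
  obtain ⟨h1, h2, h3, h4⟩ := dualBasis_mem
  have z := zero_mem integers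
  have o := one_mem integers
  simp only [← mul_assoc]
  exact S.add_mem (S.add_mem (S.add_mem
    (hS _ (mul_mem_icosians (icosianOf_mem_of_mem o z z z) hy) _ (star_mem_icosians h1))
    (hS _ (mul_mem_icosians (icosianOf_mem_of_mem z o z z) hy) _ (star_mem_icosians h2)))
    (hS _ (mul_mem_icosians (icosianOf_mem_of_mem z z o z) hy) _ (star_mem_icosians h3)))
    (hS _ (mul_mem_icosians (icosianOf_mem_of_mem z z z o) hy) _ (star_mem_icosians h4))

/-! ### The prime `√5` -/

namespace GoldenField

/-- For a = m + nτ, 4aa' = (2m + n)² - 5n², so 5 ∣ 2m + n. This says that `√5` is the only prime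
above 5. -/
theorem exists_eq_sqrtFive_mul {a : GoldenField} (ha : a ∈ integers) {k : ℤ}
    (h : a * star a = 5 * k) : ∃ b ∈ integers, a = sqrtFive * b := by
  obtain ⟨m, n, rfl⟩ := ha
  have h' : (((2 * m + n) ^ 2 : ℤ) : GoldenField) = ((5 * (n ^ 2 + 4 * k) : ℤ) : GoldenField) := by
    rw [star_add, star_mul', star_tau, star_intCast', star_intCast'] at h
    push_cast
    linear_combination 4 * h + (4 * n ^ 2 : GoldenField) * tau_mul_tau
  have h5 : (2 * m + n) ^ 2 = 5 * (n ^ 2 + 4 * k) := by exact_mod_cast h'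
  have hd : (5 : ℤ) ∣ 2 * m + n :=
    Int.Prime.dvd_pow' (p := 5) (by norm_num) (by rw [h5]; exact dvd_mul_right _ _)
  obtain ⟨l, hl⟩ := hd
  have hn : n = 5 * l - 2 * m := by omega
  refine ⟨_, ⟨2 * l - m, l, rfl⟩, ?_⟩
  rw [sqrtFive_eq, hn]
  push_cast
  linear_combination (-2 * l : GoldenField) * tau_mul_tau

theorem five_dvd_of_sqrtFive_dvd {k : ℤ} {b : GoldenField} (hb : b ∈ integers)
    (h : (k : GoldenField) = sqrtFive * b) : (5 : ℤ) ∣ k := by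
  obtain ⟨l, hl⟩ := mul_star_eq_intCast hb
  have h' : ((k ^ 2 : ℤ) : GoldenField) = ((5 * -l : ℤ) : GoldenField) := by
    have hs : star (k : GoldenField) = -(sqrtFive * star b) := by
      rw [h, star_mul', star_sqrtFive, neg_mul]
    rw [star_intCast'] at hs
    push_cast
    rw [← hl, pow_two]
    nth_rewrite 1 [h]
    rw [hs]
    linear_combination (-b * star b) * sqrtFive_mul_sqrtFive
  have h5 : k ^ 2 = 5 * -l := by exact_mod_cast h'
  exact Int.Prime.dvd_pow' (p := 5) (by norm_num) (by rw [h5]; exact dvd_mul_right _ _)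

theorem exists_eq_five_mul {a : GoldenField} (ha : a ∈ integers) {k : ℤ}
    (h : a * star a = (5 * k) ^ 2) :
    ∃ c ∈ integers, a = 5 * c ∧ c * star c = (k : GoldenField) ^ 2 := by
  have h5 : (5 : GoldenField) ≠ 0 := by norm_num
  obtain ⟨b, hb, rfl⟩ := exists_eq_sqrtFive_mul ha (k := 5 * k ^ 2)
    (by rw [h]; push_cast; ring)
  rw [star_mul', star_sqrtFive] at h
  have hb2 : b * star b = 5 * ((-k ^ 2 : ℤ) : GoldenField) := by
    apply mul_left_cancel₀ h5
    push_cast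
    linear_combination -h - (b * star b) * sqrtFive_mul_sqrtFive
  obtain ⟨c, hc, rfl⟩ := exists_eq_sqrtFive_mul hb hb2
  refine ⟨c, hc, by linear_combination c * sqrtFive_mul_sqrtFive, ?_⟩
  rw [star_mul', star_sqrtFive] at hb2
  apply mul_left_cancel₀ h5
  push_cast at hb2
  linear_combination -hb2 - (c * star c) * sqrtFive_mul_sqrtFive

/-- If `a a' = n²`, then `a` and `n` have the same valuation at `√5`. -/
theorem exists_eq_five_pow_mul {a : GoldenField} (ha : a ∈ integers) (e m : ℕ)
    (h : a * star a = (5 ^ e * m : GoldenField) ^ 2) :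
    ∃ r ∈ integers, a = 5 ^ e * r ∧ r * star r = (m : GoldenField) ^ 2 := by
  induction e generalizing a with
  | zero => exact ⟨a, ha, by simp, by simpa using h⟩
  | succ e ih =>
    obtain ⟨c, hc, rfl, hcc⟩ := exists_eq_five_mul ha (k := (5 ^ e * m : ℕ))
      (by rw [h]; push_cast; ring)
    obtain ⟨r, hr, rfl, hrr⟩ := ih hc (by rw [hcc]; push_cast; ring)
    exact ⟨r, hr, by ring, hrr⟩

theorem exists_eq_five_mul_iff {a : GoldenField} (ha : a ∈ integers) {n : ℕ}
    (h : a * star a = (n : GoldenField) ^ 2) :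
    (∃ x ∈ integers, a = 5 * x) ↔ 5 ∣ n := by
  constructor
  · rintro ⟨x, hx, rfl⟩
    obtain ⟨k, hk⟩ := mul_star_eq_intCast hx
    have h' : ((n ^ 2 : ℤ) : GoldenField) = ((5 * (5 * k) : ℤ) : GoldenField) := by
      push_cast
      rw [← h, ← hk, star_mul']
      simp only [star_ofNat]
      ring
    have h5 : (n : ℤ) ^ 2 = 5 * (5 * k) := by exact_mod_cast h'
    have := Int.Prime.dvd_pow' (p := 5) (n := n) (k := 2) (by norm_num)
      (by rw [h5]; exact dvd_mul_right _ _)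
    exact_mod_cast this
  · rintro ⟨k, rfl⟩
    obtain ⟨c, hc, hac, -⟩ := exists_eq_five_mul ha (k := k) (by rw [h]; push_cast; ring)
    exact ⟨c, hc, hac⟩

/-- Separates the behaviour at `√5` from the behaviour at the remaining primes dividing `m`. -/
theorem exists_bezout_sqrtFive {m : ℕ} (hm : ¬ 5 ∣ m) :
    ∃ u ∈ integers, ∃ v ∈ integers, u * m + v * sqrtFive = 1 := by
  have hc : Nat.Coprime m 5 := ((Nat.Prime.coprime_iff_not_dvd (by norm_num)).2 hm).symm
  have hb := Nat.gcd_eq_gcd_ab m 5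
  rw [hc.gcd_eq_one] at hb
  refine ⟨(Nat.gcdA m 5 : ℤ), intCast_mem_integers _, (Nat.gcdB m 5 : ℤ) * sqrtFive,
    mul_mem (intCast_mem_integers _) sqrtFive_mem_integers, ?_⟩
  have hb' := congrArg (Int.cast : ℤ → GoldenField) hb
  push_cast at hb'
  linear_combination -hb' + (Nat.gcdB m 5 : GoldenField) * sqrtFive_mul_sqrtFive

end GoldenField

/-! ### Skew elements modulo `√5` -/

/-- This icosian, called J below, spans the elements z - z̃ modulo `√5`; its norm 3 is not divisible
by `√5`. -/
theorem skewUnit_mem : icosianOf 0 0 (-1) 2 ∈ icosians :=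
  icosianOf_mem_of_mem (zero_mem _) (zero_mem _) (neg_mem (one_mem _)) (ofNat_mem _ 2)

theorem normSq_skewUnit : Quaternion.normSq (icosianOf 0 0 (-1) 2) = 3 := by
  rw [Quaternion.normSq_def']
  simp
  linear_combination 2 * tau_mul_tau

/-- In basis coordinates the twist is (a,b,c,d) ↦ (a',b',c'+d',-d'). Conjugation being trivial
modulo `√5`, z - z̃ reduces to (0,0,-d,2d) = dJ. -/
theorem exists_sub_twist_eq {z : ℍ[GoldenField]} (hz : z ∈ icosians) :
    ∃ k : ℤ, ∃ y ∈ icosians,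
      z - twist z = (k : GoldenField) • icosianOf 0 0 (-1) 2 + sqrtFive • y := by
  obtain ⟨⟨a, ha⟩, ⟨b, hb⟩, ⟨c, hc⟩, ⟨d, hd⟩, rfl⟩ := mem_icosians_iff.1 hz
  obtain ⟨i, hi⟩ := sub_star_eq ha
  obtain ⟨j, hj⟩ := sub_star_eq hb
  obtain ⟨l, hl⟩ := sub_star_eq hc
  obtain ⟨m, n, hmn⟩ := hd
  have hsd : star d = m + n - n * tau := by
    rw [hmn, star_add, star_mul', star_tau, star_intCast', star_intCast']
    ring
  -- From √5 = 2τ - 1 follows τ ≡ 3 modulo `√5`, hence d ≡ m + 3n.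
  refine ⟨m + 3 * n, icosianOf (i : ℤ) (j : ℤ) ((l : ℤ) + (n : ℤ) * tau)
    (-(sqrtFive * (n : ℤ))), ?_, ?_⟩
  · exact icosianOf_mem_of_mem (intCast_mem_integers _) (intCast_mem_integers _)
      ⟨_, _, rfl⟩ (neg_mem (mul_mem sqrtFive_mem_integers (intCast_mem_integers _)))
  · have h := tau_mul_tau
    have h5 := sqrtFive_eq
    rw [twist_icosianOf, hsd]
    simp only [hmn]
    generalize star a = a' at *
    generalize star b = b' at *
    generalize star c = c' at *
    apply Quaternion.ext <;> simp <;> grind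

/-- Modulo `√5` the twist is a linear anti-automorphism, hence conjugation followed by an inner
automorphism, here the one given by J. -/
theorem exists_skewUnit_mul_twist {q : ℍ[GoldenField]} (hq : q ∈ icosians) :
    ∃ y ∈ icosians, icosianOf 0 0 (-1) 2 * twist q =
      star q * icosianOf 0 0 (-1) 2 + sqrtFive • y := by
  obtain ⟨⟨a, ha⟩, ⟨b, hb⟩, ⟨c, hc⟩, ⟨d, hd⟩, rfl⟩ := mem_icosians_iff.1 hq
  obtain ⟨i, hi⟩ := sub_star_eq ha
  obtain ⟨j, hj⟩ := sub_star_eq hb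
  obtain ⟨k, hk⟩ := sub_star_eq hc
  obtain ⟨l, hl⟩ := sub_star_eq hd
  have hz := zero_mem integers
  have ho := one_mem integers
  -- The first three terms are (Jẽ - ēJ)/√5 for the basis elements e ≠ 1, weighted by conjugated
  -- coordinates. The last one accounts for replacing coordinates by their conjugates in q̄.
  refine ⟨star b • icosianOf (-1) (-1) 0 0 + star c • icosianOf 0 0 (-1) 0 +
    star d • icosianOf 0 0 (-1) 1 - star (icosianOf (i : ℤ) (j : ℤ) (k : ℤ) (l : ℤ)) *
      icosianOf 0 0 (-1) 2, ?_, ?_⟩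
  · refine sub_mem (add_mem (add_mem ?_ ?_) ?_) (mul_mem_icosians (star_mem_icosians ?_)
      skewUnit_mem)
    · exact smul_mem_icosians (star_mem_integers hb)
        (icosianOf_mem_of_mem (neg_mem ho) (neg_mem ho) hz hz)
    · exact smul_mem_icosians (star_mem_integers hc) (icosianOf_mem_of_mem hz hz (neg_mem ho) hz)
    · exact smul_mem_icosians (star_mem_integers hd) (icosianOf_mem_of_mem hz hz (neg_mem ho) ho)
    · exact icosianOf_mem_of_mem (intCast_mem_integers _) (intCast_mem_integers _)
        (intCast_mem_integers _) (intCast_mem_integers _)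
  · have h := tau_mul_tau
    rw [sqrtFive_eq] at *
    rw [twist_icosianOf]
    simp only
    rw [← sub_eq_zero] at hi hj hk hl
    generalize star a = a' at *
    generalize star b = b' at *
    generalize star c = c' at *
    generalize star d = d' at *
    apply Quaternion.ext <;> simp <;> grind

/-- A skew icosian whose norm is divisible by `√5` is divisible by `√5`. -/
theorem exists_sub_twist_eq_sqrtFive_smul {z : ℍ[GoldenField]} (hz : z ∈ icosians)
    {x : GoldenField} (hx : x ∈ integers) (h : Quaternion.normSq (z - twist z) = sqrtFive * x) :
    ∃ y ∈ icosians, z - twist z = sqrtFive • y := by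
  obtain ⟨k, y, hy, hu⟩ := exists_sub_twist_eq hz
  have ht := two_mul_re_mem (mul_mem_icosians skewUnit_mem (star_mem_icosians hy))
  -- The norm of kJ + √5y is 3k² modulo `√5`, and 3 is invertible modulo 5.
  have hkx : ((3 * k ^ 2 : ℤ) : GoldenField) = sqrtFive * (x -
      k * (2 * (icosianOf 0 0 (-1) 2 * star y).re) - sqrtFive * Quaternion.normSq y) := by
    rw [hu, normSq_add, normSq_smul', normSq_smul', normSq_skewUnit, Quaternion.star_smul,
      mul_smul_quaternion, smul_mul_quaternion, two_mul_re_smul, two_mul_re_smul] at h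
    push_cast
    linear_combination h
  have h5 := five_dvd_of_sqrtFive_dvd (sub_mem (sub_mem hx (mul_mem (intCast_mem_integers k) ht))
    (mul_mem sqrtFive_mem_integers (normSq_mem hy))) hkx
  have h5k : (5 : ℤ) ∣ k := by
    rcases Int.Prime.dvd_mul' (p := 5) (by norm_num) h5 with h | h
    · norm_num at h
    · exact Int.Prime.dvd_pow' (p := 5) (by norm_num) h
  obtain ⟨l, rfl⟩ := h5k
  refine ⟨(sqrtFive * l) • icosianOf 0 0 (-1) 2 + y, add_mem (smul_mem_icosians
    (mul_mem sqrtFive_mem_integers (intCast_mem_integers l)) skewUnit_mem) hy, ?_⟩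
  rw [hu, smul_add, smul_smul, ← mul_assoc, sqrtFive_mul_sqrtFive]
  push_cast
  rfl

/-- Since z - z̃ is kJ up to `√5`, and J p̃ is p̄ J up to `√5`, the factors p p̄ = N(p) come
together. -/
theorem exists_mul_sub_twist_mul {p z : ℍ[GoldenField]} (hp : p ∈ icosians) (hz : z ∈ icosians) :
    ∃ x ∈ icosians, ∃ y ∈ icosians,
      p * (z - twist z) * twist p = Quaternion.normSq p • x + sqrtFive • (p * y) := by
  obtain ⟨k, y, hy, hu⟩ := exists_sub_twist_eq hz
  obtain ⟨w, hw, hJ⟩ := exists_skewUnit_mul_twist hp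
  refine ⟨(k : GoldenField) • icosianOf 0 0 (-1) 2,
    smul_mem_icosians (intCast_mem_integers k) skewUnit_mem,
    (k : GoldenField) • w + y * twist p,
    add_mem (smul_mem_icosians (intCast_mem_integers k) hw)
      (mul_mem_icosians hy (twist_mem_icosians hp)), ?_⟩
  rw [hu, mul_assoc, add_mul, smul_mul_quaternion, smul_mul_quaternion, hJ, smul_add, mul_add,
    mul_add, mul_smul_quaternion, ← mul_assoc, Quaternion.self_mul_star,
    Quaternion.coe_mul_eq_smul, mul_add, smul_add, smul_comm (k : GoldenField),
    smul_comm (k : GoldenField) sqrtFive, mul_smul_quaternion, mul_smul_quaternion,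
    mul_smul_quaternion, add_assoc]

/-- The right module `p 𝕀 + (n / √5) 𝕀` contains `p w p̃` for all `w` in the dual lattice of `L`. -/
theorem exists_mul_dual_mul_twist {p z : ℍ[GoldenField]} (hp : p ∈ icosians) (hz : z ∈ icosians)
    {n : ℕ} (hn : 0 < n)
    (h : Quaternion.normSq p * star (Quaternion.normSq p) = (n : GoldenField) ^ 2) :
    ∃ x ∈ icosians, ∃ y ∈ icosians,
      p * (sqrtFive⁻¹ • (z - twist z)) * twist p = p * x + ((n : GoldenField) / sqrtFive) • y := by
  obtain ⟨e, m, hm5, rfl⟩ := Nat.exists_eq_pow_mul_and_not_dvd hn.ne' 5 (by norm_num)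
  push_cast at h
  obtain ⟨r, hr, hpr, -⟩ := exists_eq_five_pow_mul (normSq_mem hp) e m h
  have hmr : m * Quaternion.normSq p = ((5 ^ e * m : ℕ) : GoldenField) * r := by
    rw [hpr]; push_cast; ring
  obtain ⟨u, hu, v, hv, huv⟩ := exists_bezout_sqrtFive hm5
  obtain ⟨x, hx, y, hy, hxy⟩ := exists_mul_sub_twist_mul hp hz
  have hm : (m : GoldenField) ∈ integers := natCast_mem _ m
  refine ⟨(u * m) • y + v • ((z - twist z) * twist p), add_mem (smul_mem_icosians
    (mul_mem hu hm) hy) (smul_mem_icosians hv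
      (mul_mem_icosians (sub_mem hz (twist_mem_icosians hz)) (twist_mem_icosians hp))),
    (u * r) • x, smul_mem_icosians (mul_mem hu hr) hx, ?_⟩
  have h0 := sqrtFive_ne_zero
  have e1 : p * (sqrtFive⁻¹ • (z - twist z)) * twist p =
      sqrtFive⁻¹ • (p * (z - twist z) * twist p) := by
    rw [mul_smul_quaternion, smul_mul_quaternion]
  -- With um + v√5 = 1, split 1/√5 = um/√5 + v. The second part already lies in p𝕀; in the first, m
  -- N(p) = nr turns N(p)x into a multiple of n.
  have e2 : sqrtFive⁻¹ • (p * (z - twist z) * twist p) =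
      (u * m * sqrtFive⁻¹) • (p * (z - twist z) * twist p) + v • (p * (z - twist z) * twist p) := by
    rw [← add_smul_quaternion]
    congr 1
    field_simp
    linear_combination -huv
  rw [e1, e2]
  nth_rewrite 1 [hxy]
  rw [mul_add, mul_smul_quaternion, mul_smul_quaternion, ← mul_assoc p, smul_add, smul_smul,
    smul_smul, smul_smul, show u * m * sqrtFive⁻¹ * Quaternion.normSq p =
      ((5 ^ e * m : ℕ) : GoldenField) / sqrtFive * (u * r) by
      field_simp; linear_combination u * hmr,
    show u * m * sqrtFive⁻¹ * sqrtFive = u * m by field_simp]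
  abel

/-! ### Duality -/

/-- A finitely generated subgroup of a rational vector space is cut out, inside its rational span,
by the linear forms that are integral on it. -/
theorem exists_addMonoidHom_rat {V : Type*} [AddCommGroup V] [Module ℚ V] (D : AddSubgroup V)
    (hfg : D.FG) {y : V} (hy : y ∉ D) {N : ℕ} (hN : 0 < N) (hNy : N • y ∈ D) :
    ∃ f : V →+ ℚ, (∀ d ∈ D, ∃ k : ℤ, f d = k) ∧ ¬ ∃ k : ℤ, f y = k := by
  have : IsAddTorsionFree V := IsAddTorsionFree.of_module_rat V
  obtain ⟨D, rfl⟩ : ∃ E : Submodule ℤ V, E.toAddSubgroup = D := ⟨AddSubgroup.toIntSubmodule D, rfl⟩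
  have : Module.Finite ℤ D := Module.Finite.iff_fg.2 ((Submodule.fg_iff_addSubgroup_fg D).2 hfg)
  have : Module.Free ℤ D := inferInstance
  let b := Module.Free.chooseBasis ℤ D
  -- A ℤ-basis of D stays independent over ℚ, so its coordinate functions extend to V. Since N y ∈
  -- D, they are also the coordinates of y; were all of them integral, y would lie in D.
  have hli : LinearIndependent ℚ (fun i => (b i : V)) := by
    rw [← LinearIndependent.iff_fractionRing ℤ ℚ]
    exact b.linearIndependent.map' D.subtype (Submodule.ker_subtype D)
  have hD : ∀ d : D, (d : V) = ∑ i, b.repr d i • (b i : V) := by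
    intro d
    conv_lhs => rw [← b.sum_repr d]
    rw [AddSubmonoidClass.coe_finsetSum]
    rfl
  choose f hf using fun i => LinearMap.exists_extend
    ((Finsupp.lapply i : _ →ₗ[ℚ] ℚ) ∘ₗ hli.repr)
  have hfb : ∀ i j, f i (b j) = if i = j then 1 else 0 := by
    intro i j
    have h1 : (b j : V) ∈ Submodule.span ℚ (Set.range fun i => (b i : V)) :=
      Submodule.subset_span ⟨j, rfl⟩
    have h2 := LinearMap.congr_fun (hf i) ⟨_, h1⟩
    simp only [LinearMap.comp_apply, Submodule.subtype_apply,
      Finsupp.lapply_apply] at h2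
    rw [h2, hli.repr_eq_single j _ rfl, Finsupp.single_apply]
    simp only [eq_comm]
  have hfD : ∀ i (d : D), f i d = b.repr d i := by
    intro i d
    conv_lhs => rw [hD d]
    rw [map_sum]
    simp only [map_zsmul, hfb]
    simp
  have hNy' : y = ∑ i, f i y • (b i : V) := by
    have h1 := hD ⟨_, hNy⟩
    have hN' : (N : ℚ) ≠ 0 := by exact_mod_cast hN.ne'
    have h2 : (N : ℚ) • y = (N : ℚ) • ∑ i, f i y • (b i : V) := by
      rw [Finset.smul_sum]
      rw [Nat.cast_smul_eq_nsmul]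
      refine h1.trans (Finset.sum_congr rfl fun i _ => ?_)
      rw [smul_smul, ← Int.cast_smul_eq_zsmul ℚ, ← hfD]
      congr 1
      simp
    exact smul_right_injective V hN' h2
  by_contra hcon
  push Not at hcon
  have hint : ∀ i, ∃ k : ℤ, f i y = k := by
    intro i
    exact hcon (f i).toAddMonoidHom (fun d hd => ⟨_, hfD i ⟨d, hd⟩⟩)
  choose k hk using hint
  apply hy
  rw [hNy']
  refine Submodule.sum_mem _ fun i _ => ?_
  rw [hk, Int.cast_smul_eq_zsmul]
  exact D.smul_mem _ (b i).2

namespace GoldenField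

theorem exists_rep_addMonoidHom (f : GoldenField →+ ℚ) :
    ∃ κ : GoldenField, ∀ a, f a = 2 * (κ * a).re := by
  -- The trace of κa is 2 κ.re a.re + 10 κ.im a.im; compare at a = 1 and a = √5.
  refine ⟨⟨f 1 / 2, f sqrtFive / 10⟩, fun a => ?_⟩
  have ha : a = a.re • (1 : GoldenField) + a.im • sqrtFive := by
    refine QuadraticAlgebra.ext ?_ ?_
    · simp [sqrtFive]
    · simp [sqrtFive]
  conv_lhs => rw [ha]
  rw [map_add, map_rat_smul, map_rat_smul]
  simp
  ring

theorem exists_nat_mul_mem_integers (x : GoldenField) :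
    ∃ N : ℕ, 0 < N ∧ (N : GoldenField) * x ∈ integers := by
  obtain ⟨u, v⟩ := x
  refine ⟨(u - v).den * (2 * v).den, by positivity, (u - v).num * (2 * v).den,
    (2 * v).num * (u - v).den, ?_⟩
  have h1 := Rat.den_mul_eq_num (u - v)
  have h2 := Rat.den_mul_eq_num (2 * v)
  have hx : (⟨u, v⟩ : GoldenField) =
      ((u - v : ℚ) : GoldenField) + ((2 * v : ℚ) : GoldenField) * tau := by
    refine QuadraticAlgebra.ext ?_ ?_
    · rw [QuadraticAlgebra.re_add, QuadraticAlgebra.re_mul, QuadraticAlgebra.re_ratCast,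
        QuadraticAlgebra.re_ratCast, QuadraticAlgebra.im_ratCast]
      simp [tau]
      ring
    · rw [QuadraticAlgebra.im_add, QuadraticAlgebra.im_mul, QuadraticAlgebra.im_ratCast,
        QuadraticAlgebra.re_ratCast, QuadraticAlgebra.im_ratCast]
      simp [tau]
      ring
  have k1 := congrArg (Rat.cast : ℚ → GoldenField) h1
  have k2 := congrArg (Rat.cast : ℚ → GoldenField) h2
  rw [Rat.cast_mul, Rat.cast_natCast, Rat.cast_intCast] at k1 k2
  rw [hx]
  generalize ((u - v : ℚ) : GoldenField) = α at *
  generalize ((2 * v : ℚ) : GoldenField) = β at *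
  push_cast
  linear_combination ((2 * v).den : GoldenField) * k1 + ((u - v).den * tau : GoldenField) * k2

end GoldenField

theorem exists_rep_quaternion (f : ℍ[GoldenField] →+ ℚ) :
    ∃ x : ℍ[GoldenField], ∀ z, f z = 2 * (2 * (x * star z).re).re := by
  obtain ⟨e₀, a₀, b₀, c₀, d₀⟩ : ∃ e : ℍ[GoldenField], e.re = 1 ∧ e.imI = 0 ∧ e.imJ = 0 ∧
      e.imK = 0 :=
    ⟨⟨1, 0, 0, 0⟩, rfl, rfl, rfl, rfl⟩
  obtain ⟨e₁, a₁, b₁, c₁, d₁⟩ : ∃ e : ℍ[GoldenField], e.re = 0 ∧ e.imI = 1 ∧ e.imJ = 0 ∧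
      e.imK = 0 :=
    ⟨⟨0, 1, 0, 0⟩, rfl, rfl, rfl, rfl⟩
  obtain ⟨e₂, a₂, b₂, c₂, d₂⟩ : ∃ e : ℍ[GoldenField], e.re = 0 ∧ e.imI = 0 ∧ e.imJ = 1 ∧
      e.imK = 0 :=
    ⟨⟨0, 0, 1, 0⟩, rfl, rfl, rfl, rfl⟩
  obtain ⟨e₃, a₃, b₃, c₃, d₃⟩ : ∃ e : ℍ[GoldenField], e.re = 0 ∧ e.imI = 0 ∧ e.imJ = 0 ∧
      e.imK = 1 :=
    ⟨⟨0, 0, 0, 1⟩, rfl, rfl, rfl, rfl⟩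
  let i (e : ℍ[GoldenField]) : GoldenField →+ ℍ[GoldenField] :=
    AddMonoidHom.mk' (fun a => a • e) fun a b => add_smul_quaternion a b e
  obtain ⟨κ₀, h₀⟩ := exists_rep_addMonoidHom (f.comp (i e₀))
  obtain ⟨κ₁, h₁⟩ := exists_rep_addMonoidHom (f.comp (i e₁))
  obtain ⟨κ₂, h₂⟩ := exists_rep_addMonoidHom (f.comp (i e₂))
  obtain ⟨κ₃, h₃⟩ := exists_rep_addMonoidHom (f.comp (i e₃))
  obtain ⟨x, x₀, x₁, x₂, x₃⟩ : ∃ x : ℍ[GoldenField], x.re = κ₀ / 2 ∧ x.imI = κ₁ / 2 ∧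
    x.imJ = κ₂ / 2 ∧ x.imK = κ₃ / 2 := ⟨⟨_, _, _, _⟩, rfl, rfl, rfl, rfl⟩
  refine ⟨x, fun z => ?_⟩
  have hz : z = z.re • e₀ + z.imI • e₁ + z.imJ • e₂ + z.imK • e₃ := by
    apply Quaternion.ext <;> simp [*]
  have hre : 2 * (x * star z).re = κ₀ * z.re + κ₁ * z.imI + κ₂ * z.imJ + κ₃ * z.imK := by
    simp [x₀, x₁, x₂, x₃]
    ring
  conv_lhs => rw [hz]
  rw [map_add, map_add, map_add, hre]
  simp only [QuadraticAlgebra.re_add]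
  have k₀ : f (z.re • e₀) = _ := h₀ z.re
  have k₁ : f (z.imI • e₁) = _ := h₁ z.imI
  have k₂ : f (z.imJ • e₂) = _ := h₂ z.imJ
  have k₃ : f (z.imK • e₃) = _ := h₃ z.imK
  rw [k₀, k₁, k₂, k₃]
  ring

instance instFiniteIntegers : Module.Finite ℤ integers := by
  refine ⟨⟨{1, tauInt}, ?_⟩⟩
  rw [eq_top_iff]
  rintro ⟨_, m, n, rfl⟩ -
  rw [Finset.coe_pair, Submodule.mem_span_pair]
  refine ⟨m, n, Subtype.ext ?_⟩
  simp [coe_tauInt]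

instance instFiniteIcosians : Module.Finite integers icosians :=
  Module.Finite.iff_fg.2 (Submodule.fg_span
    ((((Set.finite_singleton _).insert _).insert _).insert _))

instance instFiniteIntIcosians : Module.Finite ℤ icosians := Module.Finite.trans integers icosians

/-! ### The coincidence lattice and its dual -/

/-- `x` lies in `L ∩ p L p̃ / n`, both lattices being regarded inside `ℍ(K)`. -/
def IsCoincident (p : ℍ[GoldenField]) (n : ℕ) (x : ℍ[GoldenField]) : Prop :=
  x ∈ icosians ∧ twist x = x ∧
    ∃ y ∈ icosians, star p * x * star (twist p) = (n : GoldenField) • y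

/-- The map `z ↦ (z - z̃) / √5`, which sends the icosians onto the dual lattice of `L`. -/
noncomputable def skewDual (z : ℍ[GoldenField]) : ℍ[GoldenField] := sqrtFive⁻¹ • (z - twist z)

theorem twist_skewDual (z : ℍ[GoldenField]) : twist (skewDual z) = skewDual z := by
  rw [skewDual, twist_smul, twist_sub, twist_twist, star_inv₀, star_sqrtFive, inv_neg]
  apply Quaternion.ext <;> simp <;> ring

theorem skewDual_add (y z : ℍ[GoldenField]) : skewDual (y + z) = skewDual y + skewDual z := by
  rw [skewDual, skewDual, skewDual, twist_add, ← smul_add_quaternion]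
  congr 1
  abel

theorem skewDual_zero : skewDual 0 = 0 := by
  have := skewDual_add 0 0
  simpa using this

/-- The pairing of L with (z - z̃)/√5 is the rational trace of 2 Re(x z̄)/√5, so self-duality of 𝕀
and the trace dual of `𝔬` together give the dual of L. -/
theorem trace_mul_star_skewDual {x : ℍ[GoldenField]} (hx : twist x = x) (z : ℍ[GoldenField]) :
    2 * (x * star (skewDual z)).re =
      2 * (x * star z).re / sqrtFive + star (2 * (x * star z).re / sqrtFive) := by
  have h : (x * star (twist z)).re = star (x * star z).re := by
    nth_rewrite 1 [← hx]
    rw [← twist_star, ← twist_mul, re_twist, re_mul_comm]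
  rw [skewDual, Quaternion.star_smul, mul_smul_quaternion, two_mul_re_smul, star_sub, mul_sub,
    Quaternion.re_sub, h, star_div₀, star_sqrtFive, star_mul']
  simp only [star_ofNat]
  ring

theorem mem_icosians_of_trace_skewDual {x : ℍ[GoldenField]} (hx : twist x = x)
    (h : ∀ z ∈ icosians, ∃ k : ℤ, 2 * (x * star (skewDual z)).re = k) : x ∈ icosians := by
  refine mem_icosians_of_trace fun y hy => ?_
  have hs := star_mem_icosians hy
  refine mem_integers_of_trace ?_ ?_
  · obtain ⟨k, hk⟩ := h _ hs
    rw [trace_mul_star_skewDual hx, star_star] at hk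
    exact ⟨k, hk⟩
  · obtain ⟨k, hk⟩ := h _ (smul_mem_icosians tau_mem_integers hs)
    rw [trace_mul_star_skewDual hx, Quaternion.star_smul, star_star, mul_smul_quaternion,
      two_mul_re_smul] at hk
    exact ⟨k, hk⟩

theorem trace_skewDual_int {x : ℍ[GoldenField]} (hxI : x ∈ icosians) (hx : twist x = x)
    {z : ℍ[GoldenField]} (hz : z ∈ icosians) :
    ∃ k : ℤ, 2 * (x * star (skewDual z)).re = k := by
  obtain ⟨k, hk⟩ := sub_star_eq (two_mul_re_mem (mul_mem_icosians hxI (star_mem_icosians hz)))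
  refine ⟨k, ?_⟩
  have h0 := sqrtFive_ne_zero
  rw [trace_mul_star_skewDual hx, star_div₀, star_sqrtFive, div_neg, ← sub_eq_add_neg, ← sub_div,
    hk, mul_div_cancel_left₀ _ h0]

/-- The sum of the dual lattice of `L` and its image under the rotation `R(p)`. -/
noncomputable def dualLattice (p : ℍ[GoldenField]) (n : ℕ) : AddSubgroup ℍ[GoldenField] :=
  icosians.toAddSubgroup.map (AddMonoidHom.mk' skewDual skewDual_add) ⊔
    icosians.toAddSubgroup.map (AddMonoidHom.mk'
      (fun z => (n : GoldenField)⁻¹ • (p * skewDual z * twist p)) (by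
        intro y z
        simp only [skewDual_add, mul_add, add_mul, smul_add_quaternion]))

theorem mem_dualLattice {p : ℍ[GoldenField]} {n : ℕ} {y : ℍ[GoldenField]} :
    y ∈ dualLattice p n ↔ ∃ z₁ ∈ icosians, ∃ z₂ ∈ icosians,
      y = skewDual z₁ + (n : GoldenField)⁻¹ • (p * skewDual z₂ * twist p) := by
  unfold dualLattice
  rw [AddSubgroup.mem_sup]
  constructor
  · rintro ⟨_, ⟨z₁, h₁, rfl⟩, _, ⟨z₂, h₂, rfl⟩, rfl⟩
    exact ⟨z₁, h₁, z₂, h₂, rfl⟩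
  · rintro ⟨z₁, h₁, z₂, h₂, rfl⟩
    exact ⟨_, ⟨z₁, h₁, rfl⟩, _, ⟨z₂, h₂, rfl⟩, rfl⟩

theorem dualLattice_fg (p : ℍ[GoldenField]) (n : ℕ) : (dualLattice p n).FG := by
  have h : icosians.toAddSubgroup.FG :=
    (Submodule.fg_iff_addSubgroup_fg (icosians.restrictScalars ℤ)).1
      (Module.Finite.iff_fg.1 instFiniteIntIcosians)
  obtain ⟨S, hS, hfin⟩ := (AddSubgroup.fg_iff _).1 h
  have hmap : ∀ f : ℍ[GoldenField] →+ ℍ[GoldenField], (icosians.toAddSubgroup.map f).FG :=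
    fun f => (AddSubgroup.fg_iff _).2
      ⟨f '' S, by rw [← hS, AddMonoidHom.map_closure], hfin.image f⟩
  exact (hmap _).sup (hmap _)

theorem skewDual_mem_dualLattice (p : ℍ[GoldenField]) (n : ℕ) {z : ℍ[GoldenField]}
    (hz : z ∈ icosians) : skewDual z ∈ dualLattice p n :=
  mem_dualLattice.2 ⟨z, hz, 0, icosians.zero_mem, by simp [skewDual_zero]⟩

theorem rotate_skewDual_mem_dualLattice (p : ℍ[GoldenField]) (n : ℕ) {z : ℍ[GoldenField]}
    (hz : z ∈ icosians) :
    (n : GoldenField)⁻¹ • (p * skewDual z * twist p) ∈ dualLattice p n :=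
  mem_dualLattice.2 ⟨0, icosians.zero_mem, z, hz, by simp [skewDual_zero]⟩

theorem twist_of_mem_dualLattice {p : ℍ[GoldenField]} {n : ℕ} {y : ℍ[GoldenField]}
    (hy : y ∈ dualLattice p n) : twist y = y := by
  obtain ⟨z₁, -, z₂, -, rfl⟩ := mem_dualLattice.1 hy
  rw [twist_add, twist_smul, twist_mul, twist_mul, twist_twist, twist_skewDual,
    twist_skewDual, mul_assoc]
  simp

/-- The rotation by `p` and its adjoint, for the trace form. -/
theorem trace_mul_star_rotate (p x w : ℍ[GoldenField]) (a : GoldenField) :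
    2 * (x * star (a • (p * w * twist p))).re =
      2 * (a • (star p * x * star (twist p)) * star w).re := by
  rw [Quaternion.star_smul, mul_smul_quaternion, smul_mul_quaternion, two_mul_re_smul,
    two_mul_re_smul]
  congr 2
  rw [star_mul, star_mul, ← mul_assoc, ← mul_assoc, re_mul_comm]
  simp only [mul_assoc]

theorem twist_rotate_adjoint {p x : ℍ[GoldenField]} (hx : twist x = x) (n : ℕ) :
    twist ((n : GoldenField)⁻¹ • (star p * x * star (twist p))) =
      (n : GoldenField)⁻¹ • (star p * x * star (twist p)) := by
  rw [twist_smul, twist_mul, twist_mul, hx, twist_star, twist_star, twist_twist, mul_assoc]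
  simp

theorem exists_nat_smul_mem_icosians (y : ℍ[GoldenField]) :
    ∃ N : ℕ, 0 < N ∧ (N : GoldenField) • y ∈ icosians := by
  rw [icosianOf_coords y]
  generalize y.re - y.imJ - (y.imK - y.imJ) * (1 - tau) = a
  generalize y.imI - y.imJ - (y.imK - y.imJ) * tau = b
  generalize 2 * y.imJ = c
  generalize 2 * (y.imK - y.imJ) = d
  obtain ⟨k, hk, ha⟩ := exists_nat_mul_mem_integers a
  obtain ⟨l, hl, hb⟩ := exists_nat_mul_mem_integers b
  obtain ⟨m, hm, hc⟩ := exists_nat_mul_mem_integers c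
  obtain ⟨n, hn, hd⟩ := exists_nat_mul_mem_integers d
  have hI : ∀ i : ℕ, (i : GoldenField) ∈ integers := fun i => natCast_mem _ i
  refine ⟨k * l * m * n, by positivity, ?_⟩
  have : ((k * l * m * n : ℕ) : GoldenField) • icosianOf a b c d =
      icosianOf ((l * m * n : ℕ) * (k * a)) ((k * m * n : ℕ) * (l * b)) ((k * l * n : ℕ) * (m * c))
        ((k * l * m : ℕ) * (n * d)) := by
    apply Quaternion.ext <;> simp <;> ring
  rw [this]
  exact icosianOf_mem_of_mem (mul_mem (hI _) ha) (mul_mem (hI _) hb) (mul_mem (hI _) hc)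
    (mul_mem (hI _) hd)

theorem natCast_smul_quaternion (N : ℕ) (y : ℍ[GoldenField]) :
    (N : GoldenField) • y = N • y := by
  apply Quaternion.ext <;> simp

/-- The dual of an intersection is the sum of the duals. An element outside the sum is detected by a
functional integral on it, and that functional is pairing with an element of the intersection. -/
theorem mem_dualLattice_iff {p : ℍ[GoldenField]} {n : ℕ} (hn : 0 < n) {y : ℍ[GoldenField]}
    (hy : twist y = y) :
    y ∈ dualLattice p n ↔ ∀ x, IsCoincident p n x → ∃ k : ℤ, 2 * (x * star y).re = k := by
  have hn0 : (n : GoldenField) ≠ 0 := by exact_mod_cast hn.ne'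
  constructor
  · rintro hy x ⟨hxI, hx, w, hw, hxw⟩
    obtain ⟨z₁, h₁, z₂, h₂, rfl⟩ := mem_dualLattice.1 hy
    obtain ⟨k, hk⟩ := trace_skewDual_int hxI hx h₁
    have hw' : (n : GoldenField)⁻¹ • (star p * x * star (twist p)) = w := by
      rw [hxw, smul_smul, inv_mul_cancel₀ hn0, one_smul]
    have hwt := twist_rotate_adjoint (p := p) hx n
    rw [hw'] at hwt
    obtain ⟨l, hl⟩ := trace_skewDual_int hw hwt h₂
    refine ⟨k + l, ?_⟩
    have hadd : ∀ u v : ℍ[GoldenField],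
        2 * (x * star (u + v)).re = 2 * (x * star u).re + 2 * (x * star v).re := by
      intro u v
      simp
      ring
    rw [hadd, hk, trace_mul_star_rotate, hw', hl]
    push_cast
    rfl
  · intro h
    by_contra hyD
    obtain ⟨N, hN, hNy⟩ := exists_nat_smul_mem_icosians y
    -- For twist-fixed y, √5Ny is negated by the twist, so its image under `skewDual` is 2Ny.
    have hNy' : (2 * N) • y ∈ dualLattice p n := by
      have := skewDual_mem_dualLattice p n (smul_mem_icosians sqrtFive_mem_integers hNy)
      rw [skewDual, twist_smul, twist_smul, hy, star_sqrtFive, star_natCast',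
        neg_smul_quaternion, sub_neg_eq_add, ← smul_add_quaternion, smul_smul,
            inv_mul_cancel₀ sqrtFive_ne_zero, one_smul,
        ← add_smul_quaternion, ← two_mul] at this
      rw [← natCast_smul_quaternion]
      push_cast
      exact this
    obtain ⟨f, hfD, hfy⟩ := exists_addMonoidHom_rat (dualLattice p n) (dualLattice_fg p n) hyD
      (by positivity : 0 < 2 * N) hNy'
    obtain ⟨x, hx⟩ := exists_rep_quaternion f
    -- Symmetrising x makes its pairing with twist-fixed elements rational and equal to f.
    have hsym : twist (x + twist x) = x + twist x := by
      rw [twist_add, twist_twist, add_comm]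
    have hf : ∀ z, twist z = z → 2 * ((x + twist x) * star z).re = (f z : GoldenField) := by
      intro z hz
      have h1 : (twist x * star z).re = star (x * star z).re := by
        nth_rewrite 1 [← hz]
        rw [← twist_star, ← twist_mul, re_twist, re_mul_comm]
      rw [add_mul, Quaternion.re_add, h1, hx, ← add_star_eq, star_mul']
      simp only [star_ofNat]
      ring
    have hint : ∀ z ∈ dualLattice p n, ∃ k : ℤ, 2 * ((x + twist x) * star z).re = k := by
      intro z hz
      obtain ⟨k, hk⟩ := hfD z hz
      refine ⟨k, ?_⟩
      rw [hf z (twist_of_mem_dualLattice hz), hk, Rat.cast_intCast]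
    have hco : IsCoincident p n (x + twist x) := by
      refine ⟨mem_icosians_of_trace_skewDual hsym fun z hz =>
        hint _ (skewDual_mem_dualLattice p n hz), hsym,
        (n : GoldenField)⁻¹ • (star p * (x + twist x) * star (twist p)),
        mem_icosians_of_trace_skewDual (twist_rotate_adjoint hsym n) fun z hz => ?_, ?_⟩
      · rw [← trace_mul_star_rotate]
        exact hint _ (rotate_skewDual_mem_dualLattice p n hz)
      · rw [smul_smul, mul_inv_cancel₀ hn0, one_smul]
    obtain ⟨k, hk⟩ := h _ hco
    rw [hf y hy] at hk
    exact hfy ⟨k, by exact_mod_cast hk⟩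

/-! ### Recovering norms and divisors -/

/-- The right `𝕀`-module `p 𝕀 + c 𝕀`. -/
def rightSpan (p : ℍ[GoldenField]) (c : GoldenField) : AddSubgroup ℍ[GoldenField] where
  carrier := {z | ∃ x ∈ icosians, ∃ y ∈ icosians, z = p * x + c • y}
  zero_mem' := ⟨0, zero_mem _, 0, zero_mem _, by simp⟩
  add_mem' := by
    rintro _ _ ⟨x, hx, y, hy, rfl⟩ ⟨x', hx', y', hy', rfl⟩
    exact ⟨x + x', add_mem hx hx', y + y', add_mem hy hy', by
      rw [mul_add, smul_add_quaternion]; abel⟩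
  neg_mem' := by
    rintro _ ⟨x, hx, y, hy, rfl⟩
    exact ⟨-x, neg_mem hx, -y, neg_mem hy, by
      apply Quaternion.ext <;> simp <;> ring⟩

theorem mul_mem_rightSpan {p z w : ℍ[GoldenField]} {c : GoldenField} (hz : z ∈ rightSpan p c)
    (hw : w ∈ icosians) : z * w ∈ rightSpan p c := by
  obtain ⟨x, hx, y, hy, rfl⟩ := hz
  exact ⟨x * w, mul_mem_icosians hx hw, y * w, mul_mem_icosians hy hw, by
    rw [add_mul, smul_mul_quaternion, mul_assoc]⟩

theorem smul_mem_rightSpan_of_mem_dualLattice {p : ℍ[GoldenField]} (hp : p ∈ icosians) {n : ℕ}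
    (hn : 0 < n)
    (h : Quaternion.normSq p * star (Quaternion.normSq p) = (n : GoldenField) ^ 2)
    {y : ℍ[GoldenField]} (hy : y ∈ dualLattice p n) :
    (n : GoldenField) • y ∈ rightSpan p (n / sqrtFive) := by
  have hn0 : (n : GoldenField) ≠ 0 := by exact_mod_cast hn.ne'
  obtain ⟨z₁, h₁, z₂, h₂, rfl⟩ := mem_dualLattice.1 hy
  rw [smul_add_quaternion, smul_smul, mul_inv_cancel₀ hn0, one_smul]
  refine add_mem ⟨0, zero_mem _, z₁ - twist z₁, sub_mem h₁ (twist_mem_icosians h₁), ?_⟩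
    (exists_mul_dual_mul_twist hp h₂ hn h)
  rw [skewDual, smul_smul, mul_zero, zero_add, div_eq_mul_inv]

/-- Every icosian is an `𝔬`-linear combination of elements of the dual lattice of `L`. -/
theorem eq_skewDual_add_smul_skewDual (x : ℍ[GoldenField]) :
    x = skewDual ((tau - 1) • x) + tau • skewDual x := by
  have h0 := sqrtFive_ne_zero
  rw [skewDual, skewDual, twist_smul, star_sub, star_tau, star_one, ← smul_comm sqrtFive⁻¹,
    ← smul_add_quaternion]
  rw [← inv_smul_smul₀ h0 x]
  congr 1
  rw [sqrtFive_eq, inv_smul_smul₀ (by rw [← sqrtFive_eq]; exact h0)]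
  apply Quaternion.ext <;> simp <;> ring

/-- A right `𝕀`-module containing the dual of the coincidence lattice contains `p / n`. -/
theorem IsPrimitiveIcosian.smul_mem_of_dualLattice_le {p : ℍ[GoldenField]}
    (hp : IsPrimitiveIcosian p) {n : ℕ} (S : AddSubgroup ℍ[GoldenField])
    (hS : ∀ z ∈ S, ∀ w ∈ icosians, z * w ∈ S) (h : dualLattice p n ≤ S) :
    (n : GoldenField)⁻¹ • p ∈ S := by
  -- The elements w with (p/n)w ∈ S include L* p̃ 𝕀, hence 𝕀 p̃ 𝕀, because L* spans 𝕀 over `𝔬`; this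
  -- contains 1, as p̃ is primitive.
  have key : (1 : ℍ[GoldenField]) ∈ S.comap (AddMonoidHom.mulLeft ((n : GoldenField)⁻¹ • p)) := by
    refine hp.isPrimitiveIcosian_twist.one_mem_of_mul_mem _ fun x hx y hy => ?_
    rw [AddSubgroup.mem_comap, AddMonoidHom.coe_mulLeft]
    have hd : ∀ z ∈ icosians, ∀ w ∈ icosians,
        (n : GoldenField)⁻¹ • p * (skewDual z * twist p * w) ∈ S := by
      intro z hz w hw
      have := hS _ (h (rotate_skewDual_mem_dualLattice p n hz)) w hw
      rw [smul_mul_quaternion] at this ⊢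
      simpa only [mul_assoc] using this
    have hτ : tau - 1 ∈ integers := sub_mem tau_mem_integers (one_mem _)
    have e : x * twist p * y = skewDual ((tau - 1) • x) * twist p * y +
        skewDual x * twist p * (tau • y) := by
      conv_lhs => rw [eq_skewDual_add_smul_skewDual x]
      rw [add_mul, add_mul, smul_mul_quaternion, smul_mul_quaternion, mul_smul_quaternion]
    rw [e, mul_add]
    exact add_mem (hd _ (smul_mem_icosians hτ hx) _ hy)
      (hd _ hx _ (smul_mem_icosians tau_mem_integers hy))
  rw [AddSubgroup.mem_comap, AddMonoidHom.coe_mulLeft, mul_one] at key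
  exact key

/-- Duality reverses the inclusion: D(p) ⊆ D(q) ⊆ (1/m)(q𝕀 + (m/√5)𝕀), and a right module containing
D(p) contains p/n. -/
theorem smul_mem_rightSpan_of_isCoincident {p q : ℍ[GoldenField]} (hp : IsPrimitiveIcosian p)
    (hq : q ∈ icosians) {n m : ℕ} (hn : 0 < n) (hm : 0 < m)
    (h : Quaternion.normSq q * star (Quaternion.normSq q) = (m : GoldenField) ^ 2)
    (hpq : ∀ x, IsCoincident q m x → IsCoincident p n x) :
    ((m : GoldenField) / n) • p ∈ rightSpan q (m / sqrtFive) := by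
  let f : ℍ[GoldenField] →+ ℍ[GoldenField] :=
    AddMonoidHom.mk' (fun z => (m : GoldenField) • z) fun y z => smul_add_quaternion _ y z
  have := hp.smul_mem_of_dualLattice_le (n := n) ((rightSpan q (m / sqrtFive)).comap f)
    (fun z hz w hw => by
      rw [AddSubgroup.mem_comap] at hz ⊢
      have := mul_mem_rightSpan hz hw
      rwa [show f z * w = f (z * w) from smul_mul_quaternion _ _ _] at this)
    (fun y hy => by
      have ht := twist_of_mem_dualLattice hy
      have hy' : y ∈ dualLattice q m := by
        rw [mem_dualLattice_iff hn ht] at hy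
        rw [mem_dualLattice_iff hm ht]
        exact fun x hx => hy x (hpq x hx)
      exact smul_mem_rightSpan_of_mem_dualLattice hq hm h hy')
  rw [AddSubgroup.mem_comap] at this
  rw [div_eq_mul_inv (m : GoldenField) n, ← smul_smul]
  exact this

theorem nat_dvd_of_sq_dvd_five_mul_sq {a b : ℕ} (ha : 0 < a) (h : a ^ 2 ∣ 5 * b ^ 2) : a ∣ b := by
  obtain ⟨g, a', b', hg, hc, rfl, rfl⟩ := Nat.exists_coprime' (m := a) (n := b)
    (Nat.gcd_pos_of_pos_left b ha)
  have h1 : a' ^ 2 ∣ 5 * b' ^ 2 := by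
    rw [mul_pow, mul_pow, ← mul_assoc] at h
    exact Nat.dvd_of_mul_dvd_mul_right (by positivity) h
  have h2 : a' ^ 2 ∣ 5 := (hc.pow 2 2).dvd_of_dvd_mul_right h1
  have h3 : a' = 1 := by
    have : a' ≤ 2 := by
      by_contra hlt
      have := Nat.le_of_dvd (by norm_num) h2
      nlinarith
    interval_cases a' <;> revert h2 <;> decide
  rw [h3, one_mul]
  exact dvd_mul_left _ _

/-- Multiplying by `√5` clears the denominator, so √5m/n ∈ `𝔬` by primitivity; its norm -5m²/n² is
an integer and 5 is squarefree. -/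
theorem dvd_of_smul_mem_rightSpan {p q : ℍ[GoldenField]} (hp : IsPrimitiveIcosian p)
    (hq : q ∈ icosians) {n m : ℕ} (hn : 0 < n)
    (h : ((m : GoldenField) / n) • p ∈ rightSpan q (m / sqrtFive)) : n ∣ m := by
  have hn0 : (n : GoldenField) ≠ 0 := by exact_mod_cast hn.ne'
  have h0 := sqrtFive_ne_zero
  obtain ⟨x, hx, y, hy, hxy⟩ := h
  have hmem : (sqrtFive * ((m : GoldenField) / n)) • p ∈ icosians := by
    rw [← smul_smul, hxy, smul_add_quaternion, smul_smul, mul_div_cancel₀ _ h0]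
    exact add_mem (smul_mem_icosians sqrtFive_mem_integers (mul_mem_icosians hq hx))
      (smul_mem_icosians (natCast_mem _ m) hy)
  obtain ⟨k, hk⟩ := mul_star_eq_intCast (hp.2 _ hmem)
  have hk' : ((5 * m ^ 2 : ℤ) : GoldenField) = ((n ^ 2 * -k : ℤ) : GoldenField) := by
    rw [star_mul', star_sqrtFive, star_div₀, star_natCast', star_natCast'] at hk
    push_cast
    rw [← hk, ← sqrtFive_mul_sqrtFive]
    field_simp
  have hk2 : (5 * m ^ 2 : ℤ) = n ^ 2 * -k := by exact_mod_cast hk'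
  apply nat_dvd_of_sq_dvd_five_mul_sq hn
  have : ((n ^ 2 : ℕ) : ℤ) ∣ ((5 * m ^ 2 : ℕ) : ℤ) := ⟨-k, by push_cast; exact hk2⟩
  exact_mod_cast this

/-- Write p = unp + v√5p with un + v√5 = 1; the factor `√5` cancels the denominator of n/√5. -/
theorem mem_rightSpan_of_not_dvd {p q : ℍ[GoldenField]} (hp : p ∈ icosians)
    {n : ℕ} (hn : ¬ 5 ∣ n) (h : p ∈ rightSpan q (n / sqrtFive)) : p ∈ rightSpan q n := by
  obtain ⟨u, hu, v, hv, huv⟩ := exists_bezout_sqrtFive hn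
  obtain ⟨x, hx, y, hy, hxy⟩ := h
  refine ⟨(v * sqrtFive) • x, smul_mem_icosians (mul_mem hv sqrtFive_mem_integers) hx,
    u • p + v • y, add_mem (smul_mem_icosians hu hp) (smul_mem_icosians hv hy), ?_⟩
  have e : p = (u * n) • p + (v * sqrtFive) • p := by
    rw [← add_smul_quaternion, huv, one_smul]
  have h0 := sqrtFive_ne_zero
  conv_lhs => rw [e]
  conv_lhs => rw [show (v * sqrtFive) • p = (v * sqrtFive) • (q * x + (n / sqrtFive) • y) by
    rw [← hxy]]
  rw [smul_add_quaternion, smul_add_quaternion, smul_smul, smul_smul, smul_smul,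
    mul_smul_quaternion, show v * sqrtFive * (n / sqrtFive) = n * v by field_simp, mul_comm u]
  abel

theorem exists_normSq_eq_of_mem_rightSpan {p q : ℍ[GoldenField]} (hq : q ∈ icosians)
    {c : GoldenField} (hc : c ∈ integers) (h : p ∈ rightSpan q c) :
    ∃ a ∈ integers, ∃ b ∈ integers,
      Quaternion.normSq p = a * Quaternion.normSq q + b * c := by
  obtain ⟨x, hx, y, hy, rfl⟩ := h
  refine ⟨Quaternion.normSq x, normSq_mem hx,
    2 * (q * x * star y).re + c * Quaternion.normSq y,
    add_mem (two_mul_re_mem (mul_mem_icosians (mul_mem_icosians hq hx) (star_mem_icosians hy)))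
      (mul_mem hc (normSq_mem hy)), ?_⟩
  rw [normSq_add, normSq_smul', map_mul, Quaternion.star_smul, mul_smul_quaternion,
    two_mul_re_smul]
  ring

/-- If `(r, m) = (s, m)` and `r r' = s s' = m²`, then `s` divides `r`. -/
theorem exists_eq_mul_of_span_eq {r s m a b a' b' : GoldenField} (hr : r ∈ integers)
    (hm : m ∈ integers) (hm0 : m ≠ 0) (hmm : star m = m)
    (hrr : r * star r = m ^ 2) (hss : s * star s = m ^ 2)
    (ha : a ∈ integers) (hb : b ∈ integers) (ha' : a' ∈ integers) (hb' : b' ∈ integers)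
    (h : r = a * s + b * m) (h' : s = a' * r + b' * m) :
    ∃ w ∈ integers, r = w * s := by
  have hr' := star_mem_integers hr
  -- The ideal is (r', m) = (s', m), and (r)(r', m) = m(m, r) = m(m, s) = (s)(s', m); cancel its
  -- generator δ.
  let A : AddSubgroup GoldenField :=
    { carrier := {t | ∃ x ∈ integers, ∃ y ∈ integers, t = x * star r + y * m}
      zero_mem' := ⟨0, zero_mem _, 0, zero_mem _, by simp⟩
      add_mem' := by
        rintro _ _ ⟨x, hx, y, hy, rfl⟩ ⟨x', hx', y', hy', rfl⟩
        exact ⟨x + x', add_mem hx hx', y + y', add_mem hy hy', by ring⟩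
      neg_mem' := by
        rintro _ ⟨x, hx, y, hy, rfl⟩
        exact ⟨-x, neg_mem hx, -y, neg_mem hy, by ring⟩ }
  obtain ⟨δ, ⟨x, hx, y, hy, hδ⟩, hgen⟩ := exists_generator A
    (by rintro _ ⟨x, hx, y, hy, rfl⟩; exact add_mem (mul_mem hx hr') (mul_mem hy hm))
    (by
      rintro _ ⟨x, hx, y, hy, rfl⟩ z hz
      exact ⟨z * x, mul_mem hz hx, z * y, mul_mem hz hy, by ring⟩)
  obtain ⟨t, ht, hmt⟩ := hgen m ⟨0, zero_mem _, 1, one_mem _, by ring⟩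
  obtain ⟨w, hw, hsw⟩ := hgen (star s) ⟨star a', star_mem_integers ha', star b',
    star_mem_integers hb', by
      conv_lhs => rw [h']
      rw [star_add, star_mul', star_mul', hmm]⟩
  have hδ0 : δ ≠ 0 := by
    rintro rfl
    exact hm0 (by rw [hmt, mul_zero])
  refine ⟨(x + y * b) * w + y * a * t, add_mem (mul_mem (add_mem hx (mul_mem hy hb)) hw)
    (mul_mem (mul_mem hy ha) ht), ?_⟩
  apply mul_right_cancel₀ hδ0
  calc r * δ = x * (r * star r) + y * m * r := by rw [hδ]; ring
    _ = (x + y * b) * (s * star s) + y * a * m * s := by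
        rw [hrr, hss]; linear_combination (y * m) * h
    _ = ((x + y * b) * w + y * a * t) * s * δ := by rw [hsw]; nth_rewrite 1 [hmt]; ring

/-- The divisor `c` of `n` in the second condition: `√5` if `5 ∣ n`, and `1` otherwise. -/
noncomputable def fiveDivisor (n : ℕ) : GoldenField := if 5 ∣ n then sqrtFive else 1

theorem fiveCorrection_eq {p : ℍ[GoldenField]} (hp : p ∈ icosians) {n : ℕ}
    (h : Quaternion.normSq p * star (Quaternion.normSq p) = (n : GoldenField) ^ 2) :
    fiveCorrection p = fiveDivisor n := by
  unfold fiveCorrection fiveDivisor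
  simp only [exists_eq_five_mul_iff (normSq_mem hp) h]

theorem natCast_div_sqrtFive (k : ℕ) :
    ((5 * k : ℕ) : GoldenField) / sqrtFive = sqrtFive * k := by
  have h0 := sqrtFive_ne_zero
  push_cast
  rw [← sqrtFive_mul_sqrtFive]
  field_simp

theorem natCast_div_fiveDivisor_mem (n : ℕ) : (n : GoldenField) / fiveDivisor n ∈ integers := by
  unfold fiveDivisor
  split_ifs with h
  · obtain ⟨k, rfl⟩ := h
    rw [natCast_div_sqrtFive]
    exact mul_mem sqrtFive_mem_integers (natCast_mem _ k)
  · rw [div_one]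
    exact natCast_mem _ n

/-- Cancel 5ᵉ. If c = √5, what remains holds only after multiplication by `√5`, which is invertible
modulo m. -/
theorem exists_span_eq_coprime_part {α β γ δ : GoldenField} (hγ : γ ∈ integers) (hδ : δ ∈ integers)
    {e m : ℕ} (hm5 : ¬ 5 ∣ m) (hα : α ∈ integers)
    (h : 5 ^ e * α = γ * (5 ^ e * β) + δ * (((5 ^ e * m : ℕ) : GoldenField) /
      fiveDivisor (5 ^ e * m))) :
    ∃ a ∈ integers, ∃ b ∈ integers, α = a * β + b * m := by
  have h5 : (5 ^ e : GoldenField) ≠ 0 := pow_ne_zero _ (by norm_num)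
  unfold fiveDivisor at h
  split_ifs at h with hd
  · obtain ⟨u, hu, v, hv, huv⟩ := exists_bezout_sqrtFive hm5
    have h0 := sqrtFive_ne_zero
    have h1 : sqrtFive * α = sqrtFive * γ * β + δ * m := by
      push_cast at h
      field_simp at h
      linear_combination h
    refine ⟨v * sqrtFive * γ, mul_mem (mul_mem hv sqrtFive_mem_integers) hγ, u * α + v * δ,
      add_mem (mul_mem hu hα) (mul_mem hv hδ), ?_⟩
    linear_combination v * h1 - α * huv
  · refine ⟨γ, hγ, δ, hδ, ?_⟩
    apply mul_left_cancel₀ h5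
    push_cast at h
    linear_combination h

/-- The norms are 5ᵉr and 5ᵉs with rr' = ss' = m² and 5 ∤ m. Taking norms in the two memberships
gives (r, m) = (s, m), so r and s divide each other. -/
theorem exists_unit_of_mem_rightSpan {p q : ℍ[GoldenField]} (hp : p ∈ icosians) (hq : q ∈ icosians)
    {n : ℕ} (hn : 0 < n)
    (h₁ : Quaternion.normSq p * star (Quaternion.normSq p) = (n : GoldenField) ^ 2)
    (h₂ : Quaternion.normSq q * star (Quaternion.normSq q) = (n : GoldenField) ^ 2)
    (hpq : p ∈ rightSpan q (n / fiveDivisor n)) (hqp : q ∈ rightSpan p (n / fiveDivisor n)) :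
    ∃ ε : integersˣ, Quaternion.normSq p = ((ε : integers) : GoldenField) *
      Quaternion.normSq q := by
  obtain ⟨γ, hγ, δ, hδ, e₁⟩ :=
    exists_normSq_eq_of_mem_rightSpan hq (natCast_div_fiveDivisor_mem n) hpq
  obtain ⟨γ', hγ', δ', hδ', e₂⟩ :=
    exists_normSq_eq_of_mem_rightSpan hp (natCast_div_fiveDivisor_mem n) hqp
  obtain ⟨e, m, hm5, rfl⟩ := Nat.exists_eq_pow_mul_and_not_dvd hn.ne' 5 (by norm_num)
  obtain ⟨r, hr, hpr, hrr⟩ :=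
      exists_eq_five_pow_mul (normSq_mem hp) e m (by rw [h₁]; push_cast; rfl)
  obtain ⟨s, hs, hqs, hss⟩ :=
      exists_eq_five_pow_mul (normSq_mem hq) e m (by rw [h₂]; push_cast; rfl)
  rw [hpr, hqs] at e₁ e₂
  obtain ⟨a, ha, b, hb, k₁⟩ := exists_span_eq_coprime_part hγ hδ hm5 hr e₁
  obtain ⟨a', ha', b', hb', k₂⟩ := exists_span_eq_coprime_part hγ' hδ' hm5 hs e₂
  have hm : (m : GoldenField) ∈ integers := natCast_mem _ m
  have hm0 : (m : GoldenField) ≠ 0 := by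
    rintro h
    have : m = 0 := by exact_mod_cast h
    exact hm5 (this ▸ dvd_zero 5)
  have hmm := star_natCast' m
  obtain ⟨w, hw, hrw⟩ := exists_eq_mul_of_span_eq hr hm hm0 hmm hrr hss ha hb ha' hb' k₁ k₂
  obtain ⟨w', hw', hsw⟩ := exists_eq_mul_of_span_eq hs hm hm0 hmm hss hrr ha' hb' ha hb k₂ k₁
  have hr0 : r ≠ 0 := by
    rintro rfl
    rw [zero_mul] at hrr
    exact hm0 (pow_eq_zero_iff two_ne_zero |>.1 hrr.symm)
  have hww : w * w' = 1 := by
    apply mul_right_cancel₀ hr0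
    rw [mul_assoc, ← hsw, ← hrw, one_mul]
  refine ⟨⟨⟨w, hw⟩, ⟨w', hw'⟩, Subtype.ext hww, Subtype.ext ((mul_comm _ _).trans hww)⟩, ?_⟩
  rw [hpr, hqs, hrw]
  simp only
  ring

/-! ### Sufficiency of the two conditions -/

theorem star_mul_add_star_mul (a b : ℍ[GoldenField]) :
    star b * a = ((2 * (b * star a).re : GoldenField) : ℍ[GoldenField]) - star a * b := by
  apply Quaternion.ext <;> simp <;> ring

theorem expand_rotate (a b x : ℍ[GoldenField]) (c : GoldenField) :
    (b + c • a) * x * twist (b + c • a) = b * x * twist b +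
      (star c • (b * x * twist a) + c • (a * x * twist b)) + (c * star c) • (a * x * twist a) := by
  rw [twist_add, twist_smul, add_mul, mul_add, add_mul, add_mul, smul_mul_quaternion,
    smul_mul_quaternion, smul_mul_quaternion, mul_smul_quaternion, mul_smul_quaternion, smul_smul]
  abel

theorem normSq_sub_twist (z : ℍ[GoldenField]) :
    Quaternion.normSq (z - twist z) = Quaternion.normSq z -
      2 * (z * star (twist z)).re + star (Quaternion.normSq z) := by
  rw [← normSq_twist]
  simp [Quaternion.normSq_def']
  ring

/-- The mixed term of the rotation is divisible by `√5`. -/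
theorem exists_mixed_eq_sqrtFive_smul {a b x y : ℍ[GoldenField]} (ha : a ∈ icosians)
    (hb : b ∈ icosians) (hx : x ∈ icosians) (hxt : twist x = x) (hy : y ∈ icosians)
    (hxy : b * x * twist b = sqrtFive • y) {t k : GoldenField} (ht : t ∈ integers)
    (hk : k ∈ integers) (htr : 2 * (b * star a).re = sqrtFive * t)
    (hnb : Quaternion.normSq b = sqrtFive * k) :
    ∃ w ∈ icosians, a * x * twist b - b * x * twist a = sqrtFive • w := by
  -- The element is z - z̃ for z = a x b̃, so it suffices that `√5` divides its norm N(z) - 2 Re(z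
  -- conj(z̃)) + N(z)'.
  have htw : twist (a * x * twist b) = b * x * twist a := by
    rw [twist_mul, twist_mul, twist_twist, hxt, mul_assoc]
  have hz : a * x * twist b ∈ icosians :=
    mul_mem_icosians (mul_mem_icosians ha hx) (twist_mem_icosians hb)
  have hN : Quaternion.normSq (a * x * twist b) =
      sqrtFive * -(Quaternion.normSq a * Quaternion.normSq x * star k) := by
    rw [map_mul, map_mul, normSq_twist, hnb, star_mul', star_sqrtFive]
    ring
  have hta := star_mem_icosians (twist_mem_icosians ha)
  have hsx := star_mem_icosians hx
  have hT : 2 * (a * x * twist b * star (twist (a * x * twist b))).re =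
      sqrtFive * (t * (2 * (x * twist b * star (twist a) * star x).re) -
        2 * (star a * y * star (twist a) * star x).re) := by
    have e : a * x * twist b * star (twist (a * x * twist b)) =
        (a * (x * twist b * star (twist a) * star x)) * star b := by
      rw [htw, star_mul, star_mul]
      simp only [mul_assoc]
    -- After a cyclic shift, b̄a is traded for a trace minus āb. The trace carries `√5` by `htr`,
    -- and āb completes b x b̃, which carries it by `hxy`.
    have e2 : star b * (a * (x * twist b * star (twist a) * star x)) =
        (sqrtFive * t) • (x * twist b * star (twist a) * star x) -
          sqrtFive • (star a * y * star (twist a) * star x) := by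
      rw [← mul_assoc, star_mul_add_star_mul, htr, sub_mul, Quaternion.coe_mul_eq_smul]
      congr 1
      rw [show star a * b * (x * twist b * star (twist a) * star x) =
        star a * (b * x * twist b) * star (twist a) * star x by simp only [mul_assoc], hxy,
        mul_smul_quaternion, smul_mul_quaternion, smul_mul_quaternion]
    rw [e, re_mul_comm, e2, Quaternion.re_sub, mul_sub, two_mul_re_smul, two_mul_re_smul]
    ring
  have htI := mul_mem_icosians (mul_mem_icosians (mul_mem_icosians hx (twist_mem_icosians hb))
    hta) hsx
  have hyI := mul_mem_icosians (mul_mem_icosians (mul_mem_icosians (star_mem_icosians ha) hy)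
    hta) hsx
  have hfin := exists_sub_twist_eq_sqrtFive_smul hz
    (x := -(Quaternion.normSq a * Quaternion.normSq x * star k) -
      (t * (2 * (x * twist b * star (twist a) * star x).re) -
        2 * (star a * y * star (twist a) * star x).re) +
      star (Quaternion.normSq a * Quaternion.normSq x * star k)) ?_ ?_
  · rwa [htw] at hfin
  · have h1 := mul_mem (mul_mem (normSq_mem ha) (normSq_mem hx)) (star_mem_integers hk)
    exact add_mem (sub_mem (neg_mem h1) (sub_mem (mul_mem ht (two_mul_re_mem htI))
      (two_mul_re_mem hyI))) (star_mem_integers h1)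
  · rw [normSq_sub_twist, hT, hN, star_mul' sqrtFive, star_sqrtFive, star_neg]
    ring

/-- With q̄ = b + (n/c)t̄, the term in b is divisible by n by hypothesis and the term in t because n
divides (n/c)(n/c)'. The mixed terms have the factor n if c = 1, but only n/√5 if c = √5. -/
theorem IsCoincident.of_mem_rightSpan {p q : ℍ[GoldenField]} (hp : p ∈ icosians) (hq : q ∈ icosians)
    {n : ℕ} (hn : 0 < n)
    (h₁ : Quaternion.normSq p * star (Quaternion.normSq p) = (n : GoldenField) ^ 2)
    (h₂ : Quaternion.normSq q * star (Quaternion.normSq q) = (n : GoldenField) ^ 2)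
    (hqp : q ∈ rightSpan p (n / fiveDivisor n)) {x : ℍ[GoldenField]} (hx : IsCoincident p n x) :
    IsCoincident q n x := by
  obtain ⟨hxI, hxt, y, hy, hxy⟩ := hx
  refine ⟨hxI, hxt, ?_⟩
  obtain ⟨s, hs, t, ht, rfl⟩ := hqp
  set b := star s * star p with hb
  have hsI := star_mem_icosians hs
  have htI := star_mem_icosians ht
  have hbI : b ∈ icosians := mul_mem_icosians hsI (star_mem_icosians hp)
  have hyI : star s * y * twist (star s) ∈ icosians :=
    mul_mem_icosians (mul_mem_icosians hsI hy) (twist_mem_icosians hsI)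
  have hbb : b * x * twist b = (n : GoldenField) • (star s * y * twist (star s)) := by
    rw [hb, twist_mul, show star s * star p * x * (twist (star p) * twist (star s)) =
      star s * (star p * x * twist (star p)) * twist (star s) by simp only [mul_assoc],
      twist_star p, hxy, mul_smul_quaternion, smul_mul_quaternion]
  have hq' : star (p * s + ((n : GoldenField) / fiveDivisor n) • t) =
      b + ((n : GoldenField) / fiveDivisor n) • star t := by
    rw [star_add_quaternion, star_mul, Quaternion.star_smul]
  rw [← twist_star, hq', expand_rotate, hbb]
  have hbt := mul_mem_icosians (mul_mem_icosians hbI hxI) (twist_mem_icosians htI)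
  have htb := mul_mem_icosians (mul_mem_icosians htI hxI) (twist_mem_icosians hbI)
  have htt := mul_mem_icosians (mul_mem_icosians htI hxI) (twist_mem_icosians htI)
  by_cases h5 : 5 ∣ n
  · have hf : fiveDivisor n = sqrtFive := if_pos h5
    rw [hf] at h₂ hq hq' ⊢
    obtain ⟨k, rfl⟩ := h5
    rw [natCast_div_sqrtFive] at *
    have hkI : (k : GoldenField) ∈ integers := natCast_mem _ k
    have h0 := sqrtFive_ne_zero
    have hk0 : (k : GoldenField) ≠ 0 := by
      have : k ≠ 0 := by omega
      exact_mod_cast this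
    have hnb : Quaternion.normSq b = Quaternion.normSq s * Quaternion.normSq p := by
      rw [hb, map_mul, Quaternion.normSq_star, Quaternion.normSq_star]
    have hnq : Quaternion.normSq (p * s + (sqrtFive * (k : GoldenField)) • t) =
        Quaternion.normSq b + sqrtFive * k * (2 * (b * star (star t)).re) +
          5 * k ^ 2 * Quaternion.normSq t := by
      rw [← Quaternion.normSq_star, hq', normSq_add, normSq_smul', Quaternion.star_smul,
        mul_smul_quaternion, two_mul_re_smul, Quaternion.normSq_star, mul_pow,
        pow_two sqrtFive, sqrtFive_mul_sqrtFive]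
    obtain ⟨c, hc, hpc⟩ := (exists_eq_five_mul_iff (normSq_mem hp) h₁).2 (dvd_mul_right 5 k)
    -- This τ is not the golden ratio. In the expansion of N(q), both N(q) and N(p) become multiples
    -- of 5k after multiplication by m, which shows `√5` ∣ mT; then m is removed by Bézout.
    obtain ⟨τ, hτ, hτe⟩ : ∃ τ ∈ integers, 2 * (b * star (star t)).re = sqrtFive * τ := by
      obtain ⟨e, m, hm5, hkm⟩ := Nat.exists_eq_pow_mul_and_not_dvd hn.ne' 5 (by norm_num)
      rw [hkm] at h₁ h₂
      push_cast at h₁ h₂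
      obtain ⟨r₁, hr₁, hpr₁, -⟩ := exists_eq_five_pow_mul (normSq_mem hp) e m h₁
      obtain ⟨r₂, hr₂, hpr₂, -⟩ := exists_eq_five_pow_mul (normSq_mem hq) e m h₂
      obtain ⟨u, hu, v, hv, huv⟩ := exists_bezout_sqrtFive hm5
      have hkm' : (5 * k : GoldenField) = 5 ^ e * m := by exact_mod_cast hkm
      have hT := two_mul_re_mem (mul_mem_icosians hbI (star_mem_icosians htI))
      generalize 2 * (b * star (star t)).re = T at *
      have hmT : m * T = sqrtFive * (r₂ - Quaternion.normSq s * r₁ -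
          m * k * Quaternion.normSq t) := by
        apply mul_left_cancel₀ (mul_ne_zero (mul_ne_zero h0 hk0)
          (by norm_num : (5 : GoldenField) ≠ 0))
        have e1 : m * Quaternion.normSq p = 5 * k * r₁ := by
          rw [hpr₁]; linear_combination -r₁ * hkm'
        have e2 : m * Quaternion.normSq (p * s + (sqrtFive * (k : GoldenField)) • t) =
            5 * k * r₂ := by
          rw [hpr₂]; linear_combination -r₂ * hkm'
        rw [hnq, hnb] at e2
        linear_combination 5 * e2 - 5 * Quaternion.normSq s * e1 -
          5 * k * (r₂ - Quaternion.normSq s * r₁ - m * k * Quaternion.normSq t) *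
            sqrtFive_mul_sqrtFive
      have hmI : (m : GoldenField) ∈ integers := natCast_mem _ m
      refine ⟨u * (r₂ - Quaternion.normSq s * r₁ - m * k * Quaternion.normSq t) + v * T,
        add_mem (mul_mem hu (sub_mem (sub_mem hr₂ (mul_mem (normSq_mem hs) hr₁))
          (mul_mem (mul_mem hmI hkI) (normSq_mem ht)))) (mul_mem hv hT), ?_⟩
      linear_combination u * hmT - T * huv
    obtain ⟨w, hw, hwe⟩ := exists_mixed_eq_sqrtFive_smul htI hbI hxI hxt
      (smul_mem_icosians (mul_mem sqrtFive_mem_integers hkI) hyI)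
      (by rw [hbb, smul_smul, ← mul_assoc, sqrtFive_mul_sqrtFive]; push_cast; rfl) hτ
      (mul_mem (mul_mem sqrtFive_mem_integers (normSq_mem hs)) hc) hτe
      (by rw [hnb, hpc, ← sqrtFive_mul_sqrtFive]; ring)
    -- The quotients by n = 5k: the conjugate of √5k is -√5k, so the mixed terms give √5k · √5w = nw
    -- and the last coefficient is -5k² = -nk.
    refine ⟨star s * y * twist (star s) + w - (k : GoldenField) • (star t * x * twist (star t)),
      sub_mem (add_mem hyI hw) (smul_mem_icosians hkI htt), ?_⟩
    have hst : star (sqrtFive * (k : GoldenField)) = -(sqrtFive * k) := by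
      rw [star_mul', star_sqrtFive, star_natCast', neg_mul]
    have hmid : -(sqrtFive * (k : GoldenField)) • (b * x * twist (star t)) +
        (sqrtFive * (k : GoldenField)) • (star t * x * twist b) =
        ((5 * k : ℕ) : GoldenField) • w := by
      rw [neg_smul_quaternion, neg_add_eq_sub, ← smul_sub_quaternion, hwe, smul_smul]
      congr 1
      push_cast
      linear_combination (k : GoldenField) * sqrtFive_mul_sqrtFive
    rw [hst, hmid, smul_sub_quaternion, smul_add_quaternion, smul_smul,
      show sqrtFive * (k : GoldenField) * -(sqrtFive * k) = -(((5 * k : ℕ) : GoldenField) * k) by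
        push_cast; linear_combination -(k : GoldenField) ^ 2 * sqrtFive_mul_sqrtFive,
      neg_smul_quaternion, sub_eq_add_neg]
  · have hf : fiveDivisor n = 1 := if_neg h5
    rw [hf, div_one, star_natCast']
    refine ⟨star s * y * twist (star s) + (b * x * twist (star t) + star t * x * twist b) +
      (n : GoldenField) • (star t * x * twist (star t)),
      add_mem (add_mem hyI (add_mem hbt htb)) (smul_mem_icosians (natCast_mem _ n) htt), ?_⟩
    rw [smul_add_quaternion, smul_add_quaternion, smul_add_quaternion, smul_smul]

/-! ### The coincidence lattice inside `ℍ(ℝ)` -/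

theorem toReal_tau : toReal tau = Real.goldenRatio := by
  change (1 / 2 : ℚ) • (1 : ℝ) + (1 / 2 : ℚ) • √5 = Real.goldenRatio
  rw [Rat.smul_def, Rat.smul_def, Real.goldenRatio]
  push_cast
  ring

@[simp] theorem re_quatToReal (q : ℍ[GoldenField]) : (quatToReal q).re = toReal q.re := rfl

@[simp] theorem imI_quatToReal (q : ℍ[GoldenField]) : (quatToReal q).imI = toReal q.imI := rfl

@[simp] theorem imJ_quatToReal (q : ℍ[GoldenField]) : (quatToReal q).imJ = toReal q.imJ := rfl

@[simp] theorem imK_quatToReal (q : ℍ[GoldenField]) : (quatToReal q).imK = toReal q.imK := rfl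

theorem quatToReal_mul (p q : ℍ[GoldenField]) :
    quatToReal (p * q) = quatToReal p * quatToReal q := by
  apply Quaternion.ext <;> simp

theorem quatToReal_smul (a : GoldenField) (q : ℍ[GoldenField]) :
    quatToReal (a • q) = toReal a • quatToReal q := by
  apply Quaternion.ext <;> simp

theorem quatToReal_injective : Function.Injective quatToReal := by
  intro p q h
  apply Quaternion.ext
  · exact toReal_injective (congrArg QuaternionAlgebra.re h)
  · exact toReal_injective (congrArg QuaternionAlgebra.imI h)
  · exact toReal_injective (congrArg QuaternionAlgebra.imJ h)
  · exact toReal_injective (congrArg QuaternionAlgebra.imK h)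

/-- The twist conjugates the norm, so |p p̃|² = N(p) N(p)'. Admissibility enters the algebra in this
form. -/
theorem normSq_mul_star_of_twistLength {p : ℍ[GoldenField]} {n : ℕ} (h : twistLength p = n) :
    Quaternion.normSq p * star (Quaternion.normSq p) = (n : GoldenField) ^ 2 := by
  apply toReal_injective
  rw [← normSq_twist, ← map_mul Quaternion.normSq, map_pow, map_natCast, ← h, twistLength, pow_two,
    ← Quaternion.normSq_eq_norm_mul_self, toReal_normSq, Quaternion.normSq_def']
  rfl

theorem IsPrimitiveIcosian.twistLength_pos {p : ℍ[GoldenField]} (hp : IsPrimitiveIcosian p) {n : ℕ}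
    (h : twistLength p = n) : 0 < n := by
  rcases Nat.eq_zero_or_pos n with rfl | hn
  · exfalso
    have h' := normSq_mul_star_of_twistLength h
    have h0 : Quaternion.normSq p = 0 := by simpa using h'
    obtain ⟨y, -, hy⟩ := hp.exists_trace_eq_one
    rw [eq_zero_of_normSq_eq_zero h0] at hy
    simp at hy
  · exact hn

theorem eq_intCast_of_star_eq {a : GoldenField} (ha : a ∈ integers) (h : star a = a) :
    ∃ k : ℤ, a = k := by
  obtain ⟨m, n, rfl⟩ := ha
  rw [star_add, star_mul', star_tau, star_intCast', star_intCast'] at h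
  have h' : sqrtFive * n = 0 := by rw [sqrtFive_eq]; linear_combination -h
  rcases mul_eq_zero.1 h' with h0 | h0
  · exact absurd h0 sqrtFive_ne_zero
  · exact ⟨m, by rw [h0]; ring⟩

/-- `L` consists of the icosians fixed by the twist. -/
theorem icosian_twist_eq_iff {x : ℍ[GoldenField]} : (x ∈ icosians ∧ twist x = x) ↔
    ∃ a b c d : ℤ, x = icosianOf (a - b - d) (2 * d - c) (b + d * (tau - 1))
      (d * (1 - 2 * tau)) := by
  constructor
  · rintro ⟨hx, ht⟩
    obtain ⟨⟨a, ha⟩, ⟨b, hb⟩, ⟨c, hc⟩, ⟨d, hd⟩, rfl⟩ := mem_icosians_iff.1 hx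
    rw [twist_icosianOf] at ht
    have hR := congrArg QuaternionAlgebra.re ht
    have hI := congrArg QuaternionAlgebra.imI ht
    have hJ := congrArg QuaternionAlgebra.imJ ht
    have hK := congrArg QuaternionAlgebra.imK ht
    rw [re_icosianOf, re_icosianOf] at hR
    rw [imI_icosianOf, imI_icosianOf] at hI
    rw [imJ_icosianOf, imJ_icosianOf] at hJ
    rw [imK_icosianOf, imK_icosianOf] at hK
    simp only at hR hI hJ hK
    have hd' : star d = -d := by linear_combination 2 * hJ - 2 * hK
    have hc' : star c = c + d := by linear_combination 2 * hJ - hd'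
    have ha' : star a = a := by
      linear_combination hR - hJ + (1 - tau) / 2 * hd'
    have hb' : star b = b := by
      linear_combination hI - hJ + tau / 2 * hd'
    obtain ⟨A, rfl⟩ := eq_intCast_of_star_eq ha ha'
    obtain ⟨B, rfl⟩ := eq_intCast_of_star_eq hb hb'
    obtain ⟨s, t, rfl⟩ := hc
    rw [star_add, star_mul', star_tau, star_intCast', star_intCast'] at hc'
    -- Only c = s + tτ is free besides the integers a and b, since d = c' - c. The next witnesses
    -- convert to the generators of L.
    have hdt : d = t * (1 - 2 * tau) := by linear_combination -hc'
    refine ⟨A + s + 2 * t, s + t, 2 * t - B, t, ?_⟩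
    subst hdt
    push_cast
    congr 1 <;> ring
  · rintro ⟨a, b, c, d, rfl⟩
    have hI := intCast_mem_integers
    have ht := tau_mem_integers
    have h2 : (2 : GoldenField) ∈ integers := ofNat_mem _ 2
    refine ⟨icosianOf_mem_of_mem (sub_mem (sub_mem (hI a) (hI b)) (hI d))
      (sub_mem (mul_mem h2 (hI d)) (hI c)) (add_mem (hI b) (mul_mem (hI d) (sub_mem ht (one_mem _))))
      (mul_mem (hI d) (sub_mem (one_mem _) (mul_mem h2 ht))), ?_⟩
    rw [twist_icosianOf]
    simp only [star_sub, star_add, star_mul', star_intCast', star_tau, star_ofNat, star_one]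
    congr 1 <;> ring

theorem mem_latticeL_iff {v : ℍ[ℝ]} :
    v ∈ latticeL ↔ ∃ x ∈ icosians, twist x = x ∧ quatToReal x = v := by
  have h1 : v ∈ latticeL ↔ ∃ a b c d : ℤ, v = quatToReal
      (icosianOf (a - b - d) (2 * d - c) (b + d * (tau - 1)) (d * (1 - 2 * tau))) := by
    refine mem_span_four.trans (exists_congr fun a => exists_congr fun b => exists_congr fun c =>
      exists_congr fun d => Eq.congr_right ?_)
    have hφ := Real.goldenRatio_sq
    have h2 : toReal 2 = 2 := map_ofNat toReal 2
    obtain ⟨e₁, r₁, i₁, j₁, k₁, h₁⟩ : ∃ e : ℍ[ℝ], e.re = 1 ∧ e.imI = 0 ∧ e.imJ = 0 ∧ e.imK = 0 ∧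
      (⟨1, 0, 0, 0⟩ : ℍ[ℝ]) = e := ⟨⟨1, 0, 0, 0⟩, rfl, rfl, rfl, rfl, rfl⟩
    obtain ⟨e₂, r₂, i₂, j₂, k₂, h₂⟩ : ∃ e : ℍ[ℝ], e.re = -1 / 2 ∧ e.imI = 1 / 2 ∧ e.imJ = 1 / 2 ∧
      e.imK = 1 / 2 ∧ (⟨-1 / 2, 1 / 2, 1 / 2, 1 / 2⟩ : ℍ[ℝ]) = e :=
        ⟨⟨-1 / 2, 1 / 2, 1 / 2, 1 / 2⟩, rfl, rfl, rfl, rfl, rfl⟩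
    obtain ⟨e₃, r₃, i₃, j₃, k₃, h₃⟩ : ∃ e : ℍ[ℝ], e.re = 0 ∧ e.imI = -1 ∧ e.imJ = 0 ∧ e.imK = 0 ∧
      (⟨0, -1, 0, 0⟩ : ℍ[ℝ]) = e := ⟨⟨0, -1, 0, 0⟩, rfl, rfl, rfl, rfl, rfl⟩
    obtain ⟨e₄, r₄, i₄, j₄, k₄, h₄⟩ : ∃ e : ℍ[ℝ], e.re = 0 ∧ e.imI = 1 / 2 ∧
      e.imJ = (Real.goldenRatio - 1) / 2 ∧ e.imK = -Real.goldenRatio / 2 ∧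
      (⟨0, 1 / 2, (Real.goldenRatio - 1) / 2, -Real.goldenRatio / 2⟩ : ℍ[ℝ]) = e :=
        ⟨⟨0, 1 / 2, (Real.goldenRatio - 1) / 2, -Real.goldenRatio / 2⟩, rfl, rfl, rfl, rfl, rfl⟩
    rw [h₁, h₂, h₃, h₄]
    apply Quaternion.ext
    · simp [*, toReal_tau]
      linear_combination -(d : ℝ) * hφ
    · simp [*, toReal_tau]
      linear_combination (d : ℝ) * hφ
    · simp [*, toReal_tau]
      ring
    · simp [*, toReal_tau]
      ring
  rw [h1]
  constructor
  · rintro ⟨a, b, c, d, rfl⟩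
    obtain ⟨hx, ht⟩ := icosian_twist_eq_iff.2 ⟨a, b, c, d, rfl⟩
    exact ⟨_, hx, ht, rfl⟩
  · rintro ⟨x, hx, ht, rfl⟩
    obtain ⟨a, b, c, d, rfl⟩ := icosian_twist_eq_iff.1 ⟨hx, ht⟩
    exact ⟨a, b, c, d, rfl⟩

theorem icosianRotation_quatToReal {p : ℍ[GoldenField]} {n : ℕ} (h : twistLength p = n)
    (y : ℍ[GoldenField]) : icosianRotation p (quatToReal y) =
      quatToReal ((n : GoldenField)⁻¹ • (p * y * twist p)) := by
  rw [quatToReal_smul, quatToReal_mul, quatToReal_mul, map_inv₀, map_natCast, mul_assoc,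
    icosianRotation, h, one_div]
  rfl

/-- The inverse of the rotation is x ↦ p̄ x conj(p̃)/n, because N(p) N(p̃) = n². All vectors
involved come from ℍ(K), where the embedding is injective. -/
theorem mem_icosianCSL_iff {p : ℍ[GoldenField]} {n : ℕ} (hn : 0 < n) (h : twistLength p = n)
    {v : ℍ[ℝ]} : v ∈ icosianCSL p ↔ ∃ x, IsCoincident p n x ∧ quatToReal x = v := by
  have hn0 : (n : GoldenField) ≠ 0 := by exact_mod_cast hn.ne'
  have hnorm := normSq_mul_star_of_twistLength h
  have e₁ : ∀ y, star p * (p * y * twist p) * star (twist p) = ((n : GoldenField) ^ 2) • y := by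
    intro y
    rw [show star p * (p * y * twist p) * star (twist p) =
      star p * p * y * (twist p * star (twist p)) by simp only [mul_assoc],
          Quaternion.star_mul_self,
      Quaternion.self_mul_star, Quaternion.coe_mul_eq_smul, Quaternion.mul_coe_eq_smul, smul_smul,
      normSq_twist, mul_comm, hnorm]
  have e₂ : ∀ y, p * (star p * y * star (twist p)) * twist p = ((n : GoldenField) ^ 2) • y := by
    intro y
    rw [show p * (star p * y * star (twist p)) * twist p =
      p * star p * y * (star (twist p) * twist p) by simp only [mul_assoc],
          Quaternion.star_mul_self,
      Quaternion.self_mul_star, Quaternion.coe_mul_eq_smul, Quaternion.mul_coe_eq_smul, smul_smul,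
      normSq_twist, mul_comm, hnorm]
  rw [icosianCSL, Submodule.mem_inf, Submodule.mem_map, mem_latticeL_iff]
  constructor
  · rintro ⟨⟨x, hx, hxt, rfl⟩, w, hw, hwx⟩
    obtain ⟨y, hy, hyt, rfl⟩ := mem_latticeL_iff.1 hw
    have hwx' : icosianRotation p (quatToReal y) = quatToReal x := hwx
    rw [icosianRotation_quatToReal h] at hwx'
    have hx' := quatToReal_injective hwx'
    refine ⟨x, ⟨hx, hxt, y, hy, ?_⟩, rfl⟩
    rw [← hx', mul_smul_quaternion, smul_mul_quaternion, e₁, smul_smul]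
    congr 1
    field_simp
  · rintro ⟨x, ⟨hx, hxt, y, hy, hxy⟩, rfl⟩
    refine ⟨⟨x, hx, hxt, rfl⟩, quatToReal y, mem_latticeL_iff.2 ⟨y, hy, ?_, rfl⟩, ?_⟩
    · have := twist_rotate_adjoint (p := p) hxt n
      rwa [hxy, smul_smul, inv_mul_cancel₀ hn0, one_smul] at this
    · change icosianRotation p (quatToReal y) = quatToReal x
      rw [icosianRotation_quatToReal h]
      congr 1
      have hy' : y = (n : GoldenField)⁻¹ • (star p * x * star (twist p)) := by
        rw [hxy, smul_smul, inv_mul_cancel₀ hn0, one_smul]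
      rw [hy', mul_smul_quaternion, smul_mul_quaternion, e₂, smul_smul, smul_smul]
      rw [show (n : GoldenField)⁻¹ * (n : GoldenField)⁻¹ * (n : GoldenField) ^ 2 = 1 by field_simp,
        one_smul]

theorem icosianCSL_eq_iff {p q : ℍ[GoldenField]} {n m : ℕ} (hn : 0 < n) (hm : 0 < m)
    (hp : twistLength p = n) (hq : twistLength q = m) :
    icosianCSL p = icosianCSL q ↔ ∀ x, IsCoincident p n x ↔ IsCoincident q m x := by
  constructor
  · intro h x
    have hx := SetLike.ext_iff.1 h (quatToReal x)
    rw [mem_icosianCSL_iff hn hp, mem_icosianCSL_iff hm hq] at hx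
    have hinj : ∀ P : ℍ[GoldenField] → Prop, (∃ y, P y ∧ quatToReal y = quatToReal x) ↔ P x :=
      fun P => ⟨fun ⟨y, hy, e⟩ => quatToReal_injective e ▸ hy, fun hx => ⟨x, hx, rfl⟩⟩
    rwa [hinj, hinj] at hx
  · intro h
    refine SetLike.ext fun v => ?_
    rw [mem_icosianCSL_iff hn hp, mem_icosianCSL_iff hm hq]
    simp only [h]

/-! ### Greatest left common divisors -/

theorem IcosianLeftDvd.of_mem_rightSpan {d p z : ℍ[GoldenField]} {c : GoldenField}
    (hp : IcosianLeftDvd d p) (hc : IcosianLeftDvd d (c : ℍ[GoldenField]))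
    (hz : z ∈ rightSpan p c) : IcosianLeftDvd d z := by
  obtain ⟨a, ha, rfl⟩ := hp
  obtain ⟨b, hb, hc⟩ := hc
  obtain ⟨x, hx, y, hy, rfl⟩ := hz
  refine ⟨a * x + b * y, add_mem (mul_mem_icosians ha hx) (mul_mem_icosians hb hy), ?_⟩
  rw [← Quaternion.coe_mul_eq_smul, hc, mul_add, mul_assoc, mul_assoc]

theorem exists_isIcosianGLCD {p : ℍ[GoldenField]} {c : GoldenField} (hp : p ∈ icosians)
    (hc : c ∈ integers) : ∃ g ∈ rightSpan p c, IsIcosianGLCD g p c := by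
  obtain ⟨g, hg, hgp, hgc, x, hx, y, hy, hxy⟩ :=
    exists_icosian_bezout hp (coe_mem_icosians_iff.2 hc)
  have hmem : g ∈ rightSpan p c := ⟨x, hx, y, hy, by rw [hxy, Quaternion.coe_mul_eq_smul]⟩
  exact ⟨g, hmem, hg, hgp, hgc, fun d _ hdp hdc => hdp.of_mem_rightSpan hdc hmem⟩

/-- Any glcd is a right multiple of the one supplied by Bézout, so it lies in the same right ideal.
-/
theorem IsIcosianGLCD.mem_rightSpan {g p : ℍ[GoldenField]} {c : GoldenField} (hp : p ∈ icosians)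
    (hc : c ∈ integers) (hg : IsIcosianGLCD g p c) : g ∈ rightSpan p c := by
  obtain ⟨g', hmem, hg'⟩ := exists_isIcosianGLCD hp hc
  obtain ⟨x, hx, rfl⟩ := hg.2.2.2 g' hg'.1 hg'.2.1 hg'.2.2.1
  exact mul_mem_rightSpan hmem hx

theorem IsIcosianGLCD.of_rightSpan {g p q : ℍ[GoldenField]} {c : GoldenField}
    (hg : IsIcosianGLCD g p c) (hpq : p ∈ rightSpan q c) (hqp : q ∈ rightSpan p c) :
    IsIcosianGLCD g q c :=
  ⟨hg.1, hg.2.1.of_mem_rightSpan hg.2.2.1 hqp, hg.2.2.1, fun d hd hdq hdc =>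
    hg.2.2.2 d hd (hdq.of_mem_rightSpan hdc hpq) hdc⟩

/-- A unit has norm ±1, so n² = ±m², and positivity of m excludes the minus sign. -/
theorem eq_of_normSq_eq_unit_mul {a b : GoldenField} {n m : ℕ} (hm : 0 < m)
    (ha : a * star a = (n : GoldenField) ^ 2) (hb : b * star b = (m : GoldenField) ^ 2)
    (ε : integersˣ) (h : a = ((ε : integers) : GoldenField) * b) : n = m := by
  obtain ⟨k, hk⟩ := mul_star_eq_intCast (ε : integers).2
  obtain ⟨l, hl⟩ := mul_star_eq_intCast ((ε⁻¹ : integersˣ) : integers).2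
  have hε : ((ε : integers) : GoldenField) * ((ε⁻¹ : integersˣ) : integers) = 1 := by
    have := congrArg (Subtype.val : integers → GoldenField) ε.mul_inv
    exact this
  have hkl : ((k * l : ℤ) : GoldenField) = ((1 : ℤ) : GoldenField) := by
    have hs := congrArg star hε
    rw [star_mul', star_one] at hs
    push_cast
    rw [← hk, ← hl]
    linear_combination hε * (star ((ε : integers) : GoldenField) *
      star (((ε⁻¹ : integersˣ) : integers) : GoldenField)) + hs
  have hkl' : k * l = 1 := by exact_mod_cast hkl
  have hnm : ((n ^ 2 : ℤ) : GoldenField) = ((k * m ^ 2 : ℤ) : GoldenField) := by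
    push_cast
    rw [← ha, ← hk, ← hb, h, star_mul']
    ring
  have hnm' : (n : ℤ) ^ 2 = k * m ^ 2 := by exact_mod_cast hnm
  have hm' : (0 : ℤ) < m := by exact_mod_cast hm
  rcases Int.eq_one_or_neg_one_of_mul_eq_one hkl' with rfl | rfl
  · have : (n : ℤ) = m := by
      rw [one_mul] at hnm'
      exact (sq_eq_sq₀ (by positivity) (by positivity)).1 hnm'
    exact_mod_cast this
  · nlinarith [sq_nonneg (n : ℤ)]

theorem mem_rightSpan_fiveDivisor {p q : ℍ[GoldenField]} (hp : p ∈ icosians) {n : ℕ}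
    (h : p ∈ rightSpan q (n / sqrtFive)) : p ∈ rightSpan q (n / fiveDivisor n) := by
  unfold fiveDivisor
  split_ifs with h5
  · exact h
  · rw [div_one]
    exact mem_rightSpan_of_not_dvd hp h5 h

/-- The icosians `p₁`, `p₂` are primitive and admissible, `nᵢ` being the natural number `|pᵢ p̃ᵢ|`.
Norms are compared up to units of `𝔬`. Greatest left common divisors are determined up to right
multiplication by units of `𝕀`, so two of them "are equal" when they have a common value `g`. -/
theorem theorem3 (p₁ p₂ : ℍ[GoldenField])
    (hp₁ : IsPrimitiveIcosian p₁) (hp₂ : IsPrimitiveIcosian p₂)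
    (n₁ n₂ : ℕ) (hn₁ : twistLength p₁ = n₁) (hn₂ : twistLength p₂ = n₂) :
    icosianCSL p₁ = icosianCSL p₂ ↔
      (∃ ε : GoldenField.integersˣ,
          Quaternion.normSq p₁ = ((ε : GoldenField.integers) : GoldenField) *
            Quaternion.normSq p₂) ∧
        ∃ g : ℍ[GoldenField],
          IsIcosianGLCD g p₁ (((n₁ : GoldenField) / fiveCorrection p₁ : GoldenField)) ∧
          IsIcosianGLCD g p₂ (((n₂ : GoldenField) / fiveCorrection p₂ : GoldenField)) := by
  have pos₁ := hp₁.twistLength_pos hn₁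
  have pos₂ := hp₂.twistLength_pos hn₂
  have norm₁ := normSq_mul_star_of_twistLength hn₁
  have norm₂ := normSq_mul_star_of_twistLength hn₂
  rw [icosianCSL_eq_iff pos₁ pos₂ hn₁ hn₂, fiveCorrection_eq hp₁.1 norm₁,
    fiveCorrection_eq hp₂.1 norm₂]
  constructor
  · intro h
    have h₁ := smul_mem_rightSpan_of_isCoincident hp₁ hp₂.1 pos₁ pos₂ norm₂ fun x => (h x).2
    have h₂ := smul_mem_rightSpan_of_isCoincident hp₂ hp₁.1 pos₂ pos₁ norm₁ fun x => (h x).1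
    obtain rfl : n₁ = n₂ := Nat.dvd_antisymm (dvd_of_smul_mem_rightSpan hp₁ hp₂.1 pos₁ h₁)
      (dvd_of_smul_mem_rightSpan hp₂ hp₁.1 pos₂ h₂)
    have hn0 : (n₁ : GoldenField) ≠ 0 := by exact_mod_cast pos₁.ne'
    rw [div_self hn0, one_smul] at h₁ h₂
    have k₁ := mem_rightSpan_fiveDivisor hp₁.1 h₁
    have k₂ := mem_rightSpan_fiveDivisor hp₂.1 h₂
    refine ⟨exists_unit_of_mem_rightSpan hp₁.1 hp₂.1 pos₁ norm₁ norm₂ k₁ k₂, ?_⟩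
    obtain ⟨g, -, hg⟩ := exists_isIcosianGLCD hp₁.1 (natCast_div_fiveDivisor_mem n₁)
    exact ⟨g, hg, hg.of_rightSpan k₁ k₂⟩
  · rintro ⟨⟨ε, hε⟩, g, hg₁, hg₂⟩
    obtain rfl := eq_of_normSq_eq_unit_mul pos₂ norm₁ norm₂ ε hε
    have hc := natCast_div_fiveDivisor_mem n₁
    -- The common glcd g lies in p𝕀 + (n/c)𝕀, and q is a right multiple of g.
    have key : ∀ p q : ℍ[GoldenField], p ∈ icosians →
        IsIcosianGLCD g p (n₁ / fiveDivisor n₁ : GoldenField) →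
        IsIcosianGLCD g q (n₁ / fiveDivisor n₁ : GoldenField) →
        q ∈ rightSpan p (n₁ / fiveDivisor n₁) := by
      intro p q hp hgp hgq
      obtain ⟨x, hx, rfl⟩ := hgq.2.1
      exact mul_mem_rightSpan (hgp.mem_rightSpan hp hc) hx
    exact fun x => ⟨fun hx => hx.of_mem_rightSpan hp₁.1 hp₂.1 pos₁ norm₁ norm₂
        (key _ _ hp₁.1 hg₁ hg₂),
      fun hx => hx.of_mem_rightSpan hp₂.1 hp₁.1 pos₁ norm₂ norm₁ (key _ _ hp₂.1 hg₂ hg₁)⟩
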